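/- Let $\Bbbk$ be a field and let $\mathfrak g$ be a (right) Leibniz algebra over $\Bbbk$: a $\Bbbk$-vector space with a bilinear product satisfying $x(yz)=(xy)z-(xz)y$. Let $\mathfrak g_{\mathrm{Lie}}=\mathfrak g/\langle x^2\mid x\in\mathfrak g\rangle_{\Bbbk}$ be the associated Lie algebra (write $\overline{x}$ for the class of $x$), $U(\mathfrak g_{\mathrm{Lie}})$ its universal enveloping algebra, and let $UL(\mathfrak g)$ be the quotient of the tensor algebra $T(\mathfrak g^l\oplus\mathfrak g^r)$ on two copies of $\mathfrak g$ (with generators $l_x$, $r_x$ for $x\in\mathfrak g$) by the two-sided ideal generated by the relations $r_{xy}=[r_x,r_y]$, $l_{xy}=[l_x,r_y]$, $(r_x+l_x)l_y=0$. Let $d_0,d_1:UL(\mathfrak g)\to U(\mathfrak g_{\mathrm{Lie}})$ be the algebra morphisms with $d_0(l_x)=0$, $d_0(r_x)=\overline{x}$ and $d_1(l_x)=-\overline{x}$, $d_1(r_x)=\overline{x}$; restriction of right (resp. left) modules along $d_i$ is written $(-)^{d_i}$ (resp. ${}^{d_i}(-)$). Let $\mathfrak g^\downarrow$ be $\mathfrak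 g$ with the right $\mathfrak g_{\mathrm{Lie}}$-action $x\cdot\overline{y}=xy$; for a right $\mathfrak g_{\mathrm{Lie}}$-module $M$, the tensor product $M\otimes\mathfrak g^\downarrow$ over $\Bbbk$ carries the diagonal right $\mathfrak g_{\mathrm{Lie}}$-action. For a right $\mathfrak g_{\mathrm{Lie}}$-module $M$, let $\mathrm{lext}(M)$ be the right $UL(\mathfrak g)$-module with underlying space $(M\otimes\mathfrak g)\oplus M$ and action $$[m\otimes x,n]\,r_y=[my\otimes x+m\otimes xy,\ ny],\qquad [m\otimes x,n]\,l_z=[n\otimes z,\ -nz],$$ and let $[\mathrm{lext}(M)]\in\mathrm{Ext}^1_{UL(\mathfrak g)}(M^{d_1},(M\otimes\mathfrak g^\downarrow)^{d_0})$ be the class of the short exact sequence of right $UL(\mathfrak g)$-modules $$0\to(M\otimes\mathfrak g^\downarrow)^{d_0}\to\mathrm{lext}(M)\to M^{d_1}\to0 .$$ Then for every $n\ge 0$ there is an isomorphism of $\Bbbk$-vector spaces, natural in the right $\mathfrak g_{\mathrm{Lie}}$-module $M$ and the left $\mathfrak g_{\mathrm{Lie}}$-module $N$, $$\mathrm{Tor}^{UL(\mathfrak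 g)}_n(M^{d_1},{}^{d_1}N)\ \cong\ \mathrm{Tor}^{U(\mathfrak g_{\mathrm{Lie}})}_n(M,N)\ \oplus\ \mathrm{Tor}^{UL(\mathfrak g)}_{n-1}\big((M\otimes\mathfrak g^\downarrow)^{d_0},{}^{d_1}N\big)$$ (where $\mathrm{Tor}_{-1}=0$), whose component $\mathrm{Tor}^{UL(\mathfrak g)}_n(M^{d_1},{}^{d_1}N)\to\mathrm{Tor}^{UL(\mathfrak g)}_{n-1}((M\otimes\mathfrak g^\downarrow)^{d_0},{}^{d_1}N)$ is the cap product with $[\mathrm{lext}(M)]$. -/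

import Mathlib

open CategoryTheory CategoryTheory.Limits

universe u

set_option linter.unusedSectionVars false

/-! ### Leibniz algebras and the associated Lie algebra -/

/-- A (not necessarily associative, not necessarily unital) ring is (right) Leibniz when its
product satisfies `x (y z) = (x y) z - (x z) y`. A Leibniz algebra over a field `k` is a `k`-vector
space with a `k`-bilinear product satisfying this identity. -/
class IsLeibniz (g : Type u) [NonUnitalNonAssocRing g] : Prop where
  leibniz : ∀ x y z : g, x * (y * z) = (x * y) * z - (x * z) * y

namespace LeibnizAlg

variable (k g : Type u) [Field k] [NonUnitalNonAssocRing g] [Module k g]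

theorem mul_sq_eq_zero {g : Type u} [NonUnitalNonAssocRing g] [IsLeibniz g] (x y : g) :
    x * (y * y) = 0 := by
  rw [IsLeibniz.leibniz, sub_self]

/-- The subspace spanned by the squares `x²`. -/
def squares : Submodule k g := Submodule.span k (Set.range fun x : g => x * x)

theorem sq_mem (x : g) : x * x ∈ squares k g := Submodule.subset_span ⟨x, rfl⟩

theorem mul_add_mul_mem (x y : g) : x * y + y * x ∈ squares k g := by
  have h := sub_mem (sub_mem (sq_mem k g (x + y)) (sq_mem k g x)) (sq_mem k g y)
  have e : (x + y) * (x + y) - x * x - y * y = x * y + y * x := by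
    simp only [mul_add, add_mul]; abel
  rwa [e] at h

/-- The Lie algebra `g_Lie = g / ⟨x² | x ∈ g⟩`. -/
def LieQuot : Type u := g ⧸ squares k g

instance : AddCommGroup (LieQuot k g) := inferInstanceAs (AddCommGroup (g ⧸ squares k g))

instance : Module k (LieQuot k g) := inferInstanceAs (Module k (g ⧸ squares k g))

/-- The canonical surjection `g → g_Lie`. -/
def toLie : g →ₗ[k] LieQuot k g := (squares k g).mkQ

theorem toLie_surjective : Function.Surjective (toLie k g) := Submodule.mkQ_surjective _

theorem toLie_eq_zero_iff (x : g) : toLie k g x = 0 ↔ x ∈ squares k g :=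
  Submodule.Quotient.mk_eq_zero _

variable [IsScalarTower k g g] [SMulCommClass k g g] [IsLeibniz g]

theorem mul_squares (x : g) : ∀ s ∈ squares k g, x * s = 0 := by
  intro s hs
  induction hs using Submodule.span_induction with
  | mem s hs => obtain ⟨y, rfl⟩ := hs; exact mul_sq_eq_zero x y
  | zero => exact mul_zero x
  | add a b _ _ ha hb => rw [mul_add, ha, hb, add_zero]
  | smul c a _ ha => rw [mul_smul_comm, ha, smul_zero]

theorem squares_mul (y : g) : ∀ s ∈ squares k g, s * y ∈ squares k g := by
  intro s hs
  induction hs using Submodule.span_induction with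
  | mem s hs =>
    obtain ⟨x, rfl⟩ := hs
    have h := IsLeibniz.leibniz x x y
    have e : x * x * y = x * (x * y) + x * y * x := by rw [h]; abel
    change x * x * y ∈ _
    rw [e]
    exact mul_add_mul_mem k g x (x * y)
  | zero => rw [zero_mul]; exact zero_mem _
  | add a b _ _ ha hb => rw [add_mul]; exact add_mem ha hb
  | smul c a _ ha => rw [smul_mul_assoc]; exact Submodule.smul_mem _ c ha

/-- The right `g_Lie`-module `g↓`, i.e. the right action of `g_Lie` on `g` by right
multiplication; the operator attached to the class of `y` is `x ↦ x y`. -/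
def gDown : LieQuot k g →ₗ[k] Module.End k g :=
  (squares k g).liftQ (LinearMap.mul k g).flip (by
    intro s hs
    rw [LinearMap.mem_ker]
    ext x
    exact mul_squares k g x s hs)

@[simp] theorem gDown_toLie (x y : g) : gDown k g (toLie k g y) x = x * y := rfl

/-- The bilinear product of `g_Lie` induced by that of `g`. -/
def lieMul : LieQuot k g →ₗ[k] LieQuot k g →ₗ[k] LieQuot k g :=
  (squares k g).liftQ
    (LinearMap.flip ((squares k g).liftQ ((LinearMap.mul k g).compr₂ (toLie k g)).flip (by
      intro s hs
      rw [LinearMap.mem_ker]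
      ext x
      change toLie k g (x * s) = 0
      rw [mul_squares k g x s hs, map_zero])))
    (by
      intro s hs
      rw [LinearMap.mem_ker]
      refine LinearMap.ext fun y => ?_
      obtain ⟨y, rfl⟩ := toLie_surjective k g y
      change toLie k g (s * y) = 0
      rw [toLie_eq_zero_iff]
      exact squares_mul k g y s hs)

@[simp] theorem lieMul_toLie (x y : g) :
    lieMul k g (toLie k g x) (toLie k g y) = toLie k g (x * y) := rfl

theorem lieMul_self (x : LieQuot k g) : lieMul k g x x = 0 := by
  obtain ⟨x, rfl⟩ := toLie_surjective k g x
  rw [lieMul_toLie, toLie_eq_zero_iff]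
  exact sq_mem k g x

theorem lieMul_skew (x y : LieQuot k g) : lieMul k g x y = - lieMul k g y x := by
  have h := lieMul_self k g (x + y)
  simp only [map_add, LinearMap.add_apply, lieMul_self, zero_add, add_zero] at h
  exact eq_neg_of_add_eq_zero_right h

instance : LieRing (LieQuot k g) where
  bracket x y := lieMul k g x y
  add_lie x y z := by change lieMul k g (x + y) z = lieMul k g x z + lieMul k g y z; simp
  lie_add x y z := by change lieMul k g x (y + z) = lieMul k g x y + lieMul k g x z; simp
  lie_self x := lieMul_self k g x
  leibniz_lie x y z := by
    change lieMul k g x (lieMul k g y z) =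
      lieMul k g (lieMul k g x y) z + lieMul k g y (lieMul k g x z)
    rw [lieMul_skew k g y (lieMul k g x z)]
    obtain ⟨x, rfl⟩ := toLie_surjective k g x
    obtain ⟨y, rfl⟩ := toLie_surjective k g y
    obtain ⟨z, rfl⟩ := toLie_surjective k g z
    simp only [lieMul_toLie]
    rw [IsLeibniz.leibniz, map_sub, sub_eq_add_neg]

instance : LieAlgebra k (LieQuot k g) where
  lie_smul c x y := by change lieMul k g x (c • y) = c • lieMul k g x y; simp

theorem bracket_toLie (x y : g) : ⁅toLie k g x, toLie k g y⁆ = toLie k g (x * y) := rfl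

/-! ### The enveloping algebras -/

/-- The universal enveloping algebra `U(g_Lie)`. -/
abbrev U : Type u := UniversalEnvelopingAlgebra k (LieQuot k g)

section

attribute [local instance] LieRing.ofAssociativeRing

/-- The canonical map `g_Lie → U(g_Lie)`. -/
noncomputable def ιLie : LieQuot k g →ₗ[k] U k g :=
  (UniversalEnvelopingAlgebra.ι k : LieQuot k g →ₗ⁅k⁆ U k g).toLinearMap

theorem ιLie_lie (x y : LieQuot k g) :
    ιLie k g ⁅x, y⁆ = ιLie k g x * ιLie k g y - ιLie k g y * ιLie k g x := by
  change UniversalEnvelopingAlgebra.ι k ⁅x, y⁆ = _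
  rw [LieHom.map_lie, LieRing.of_associative_ring_bracket]
  rfl

/-- The image `x̄` of `x ∈ g` in `U(g_Lie)`. -/
noncomputable def ιU : g →ₗ[k] U k g := ιLie k g ∘ₗ toLie k g

theorem ιU_mul (x y : g) : ιU k g (x * y) = ιU k g x * ιU k g y - ιU k g y * ιU k g x := by
  change ιLie k g (toLie k g (x * y)) = _
  rw [← bracket_toLie, ιLie_lie]
  rfl

variable {k g} in
/-- A linear map `f : g_Lie → B` to an associative algebra with `f [x, y] = f x f y - f y f x`
extends to `U(g_Lie)`. -/
noncomputable def liftU {B : Type*} [Ring B] [Algebra k B] (f : LieQuot k g →ₗ[k] B)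
    (hf : ∀ x y, f ⁅x, y⁆ = f x * f y - f y * f x) : U k g →ₐ[k] B :=
  UniversalEnvelopingAlgebra.lift k
    ({ f with map_lie' := fun {x y} => hf x y } : LieQuot k g →ₗ⁅k⁆ B)

variable {k g} in
theorem liftU_ιU {B : Type*} [Ring B] [Algebra k B] (f : LieQuot k g →ₗ[k] B)
    (hf : ∀ x y, f ⁅x, y⁆ = f x * f y - f y * f x) (x : g) :
    liftU f hf (ιU k g x) = f (toLie k g x) :=
  UniversalEnvelopingAlgebra.lift_ι_apply k
    ({ f with map_lie' := fun {x y} => hf x y } : LieQuot k g →ₗ⁅k⁆ B) (toLie k g x)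

end

variable {k g} in
theorem U_induction {P : U k g → Prop} (hc : ∀ c : k, P (algebraMap k _ c))
    (hι : ∀ x : g, P (ιU k g x)) (hadd : ∀ a b, P a → P b → P (a + b))
    (hmul : ∀ a b, P a → P b → P (a * b)) (a : U k g) : P a := by
  obtain ⟨t, rfl⟩ : ∃ t, UniversalEnvelopingAlgebra.mkAlgHom k (LieQuot k g) t = a :=
    Quotient.exists_rep a
  induction t using TensorAlgebra.induction with
  | algebraMap c => rw [AlgHom.commutes]; exact hc c
  | ι x => obtain ⟨x, rfl⟩ := toLie_surjective k g x; exact hι x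
  | mul a b ha hb => rw [map_mul]; exact hmul _ _ ha hb
  | add a b ha hb => rw [map_add]; exact hadd _ _ ha hb

/-- The linear generator `l_x` in `T(gˡ ⊕ gʳ)`. -/
noncomputable def preL (x : g) : TensorAlgebra k (g × g) := TensorAlgebra.ι k (x, 0)

/-- The linear generator `r_x` in `T(gˡ ⊕ gʳ)`. -/
noncomputable def preR (x : g) : TensorAlgebra k (g × g) := TensorAlgebra.ι k (0, x)

/-- The defining relations of `UL(g)`: `r_{xy} = [r_x, r_y]`, `l_{xy} = [l_x, r_y]` and
`(r_x + l_x) l_y = 0`. -/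
inductive ULRel : TensorAlgebra k (g × g) → TensorAlgebra k (g × g) → Prop
  | rr (x y : g) : ULRel (preR k g (x * y)) (preR k g x * preR k g y - preR k g y * preR k g x)
  | lr (x y : g) : ULRel (preL k g (x * y)) (preL k g x * preR k g y - preR k g y * preL k g x)
  | rl (x y : g) : ULRel ((preR k g x + preL k g x) * preL k g y) 0

/-- The enveloping algebra `UL(g)` of a Leibniz algebra: the quotient of the tensor algebra
`T(gˡ ⊕ gʳ)` by the two-sided ideal generated by the relations `ULRel`. -/
def UL : Type u := RingQuot (ULRel k g)

noncomputable instance : Ring (UL k g) := inferInstanceAs (Ring (RingQuot (ULRel k g)))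

noncomputable instance : Algebra k (UL k g) :=
  inferInstanceAs (Algebra k (RingQuot (ULRel k g)))

/-- The quotient map `T(gˡ ⊕ gʳ) → UL(g)`. -/
noncomputable def mkUL : TensorAlgebra k (g × g) →ₐ[k] UL k g := RingQuot.mkAlgHom k (ULRel k g)

/-- The generator `l_x` of `UL(g)`. -/
noncomputable def lGen (x : g) : UL k g := mkUL k g (preL k g x)

/-- The generator `r_x` of `UL(g)`. -/
noncomputable def rGen (x : g) : UL k g := mkUL k g (preR k g x)

variable {k g} in
theorem UL_induction {P : UL k g → Prop} (hc : ∀ c : k, P (algebraMap k _ c))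
    (hl : ∀ x : g, P (lGen k g x)) (hr : ∀ x : g, P (rGen k g x))
    (hadd : ∀ a b, P a → P b → P (a + b))
    (hmul : ∀ a b, P a → P b → P (a * b)) (a : UL k g) : P a := by
  obtain ⟨t, rfl⟩ : ∃ t, mkUL k g t = a := RingQuot.mkAlgHom_surjective k (ULRel k g) a
  induction t using TensorAlgebra.induction with
  | algebraMap c => rw [AlgHom.commutes]; exact hc c
  | ι x =>
    have e : TensorAlgebra.ι k x = preL k g x.1 + preR k g x.2 := by
      rw [preL, preR, ← map_add]; simp
    rw [e, map_add]
    exact hadd _ _ (hl _) (hr _)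
  | mul a b ha hb => rw [map_mul]; exact hmul _ _ ha hb
  | add a b ha hb => rw [map_add]; exact hadd _ _ ha hb

variable {k g} in
/-- Linear maps `l, r : g → B` to an associative algebra that satisfy the relations of `UL(g)`
extend to an algebra morphism `UL(g) → B` with `l_x ↦ l x` and `r_x ↦ r x`. -/
noncomputable def liftUL {B : Type*} [Ring B] [Algebra k B] (l r : g →ₗ[k] B)
    (hrr : ∀ x y, r (x * y) = r x * r y - r y * r x)
    (hlr : ∀ x y, l (x * y) = l x * r y - r y * l x)
    (hrl : ∀ x y, (r x + l x) * l y = 0) : UL k g →ₐ[k] B :=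
  RingQuot.liftAlgHom k ⟨TensorAlgebra.lift k (l.coprod r), by
    intro a b h
    induction h with
    | rr x y => simpa [preR] using hrr x y
    | lr x y => simpa [preR, preL] using hlr x y
    | rl x y => simpa [preR, preL] using hrl x y⟩

section

variable {k g} {B : Type*} [Ring B] [Algebra k B] (l r : g →ₗ[k] B)
    (hrr : ∀ x y, r (x * y) = r x * r y - r y * r x)
    (hlr : ∀ x y, l (x * y) = l x * r y - r y * l x)
    (hrl : ∀ x y, (r x + l x) * l y = 0)

theorem liftUL_lGen (x : g) : liftUL l r hrr hlr hrl (lGen k g x) = l x :=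
  (RingQuot.liftAlgHom_mkAlgHom_apply k _ _ _).trans (by simp [preL])

theorem liftUL_rGen (x : g) : liftUL l r hrr hlr hrl (rGen k g x) = r x :=
  (RingQuot.liftAlgHom_mkAlgHom_apply k _ _ _).trans (by simp [preR])

end

/-- The algebra morphism `d₀ : UL(g) → U(g_Lie)` with `d₀ l_x = 0` and `d₀ r_x = x̄`. -/
noncomputable def d₀ : UL k g →ₐ[k] U k g :=
  liftUL 0 (ιU k g) (ιU_mul k g) (by simp) (by simp)

/-- The algebra morphism `d₁ : UL(g) → U(g_Lie)` with `d₁ l_x = -x̄` and `d₁ r_x = x̄`. -/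
noncomputable def d₁ : UL k g →ₐ[k] U k g :=
  liftUL (-ιU k g) (ιU k g) (ιU_mul k g)
    (by intro x y; simp only [LinearMap.neg_apply, ιU_mul]; noncomm_ring) (by simp)

theorem d₀_lGen (x : g) : d₀ k g (lGen k g x) = 0 := liftUL_lGen ..

theorem d₀_rGen (x : g) : d₀ k g (rGen k g x) = ιU k g x := liftUL_rGen ..

theorem d₁_lGen (x : g) : d₁ k g (lGen k g x) = -ιU k g x := liftUL_lGen ..

theorem d₁_rGen (x : g) : d₁ k g (rGen k g x) = ιU k g x := liftUL_rGen ..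

end LeibnizAlg

/-! ### Tensor product and `Tor` over a noncommutative algebra

Right `A`-modules are modules over the opposite algebra `Aᵐᵒᵖ`. -/

namespace NCTor

open MulOpposite TensorProduct

open scoped ModuleCat

variable (k : Type u) [Field k] (A : Type u) [Ring A] [Algebra k A]

variable {A} in
/-- The subspace of `M ⊗_k N` spanned by the elements `m a ⊗ n - m ⊗ a n`. -/
def balanced (M : ModuleCat.{u} Aᵐᵒᵖ) (N : ModuleCat.{u} A) : Submodule k (M ⊗[k] N) :=
  Submodule.span k {t | ∃ (m : M) (a : A) (n : N), t = (op a • m) ⊗ₜ[k] n - m ⊗ₜ[k] (a • n)}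

variable {A} in
/-- Two module morphisms induce a map of tensor products over `A`. -/
noncomputable def tensorMap {M M' : ModuleCat.{u} Aᵐᵒᵖ} {N N' : ModuleCat.{u} A}
    (f : M ⟶ M') (h : N ⟶ N') :
    ((M ⊗[k] N) ⧸ balanced k M N) →ₗ[k] ((M' ⊗[k] N') ⧸ balanced k M' N') :=
  (balanced k M N).mapQ (balanced k M' N')
    (TensorProduct.map (f.hom.restrictScalars k) (h.hom.restrictScalars k)) (by
      rw [balanced, Submodule.span_le]
      rintro _ ⟨m, a, n, rfl⟩
      refine Submodule.subset_span ⟨f.hom m, a, h.hom n, ?_⟩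
      simp)

/-- The functor `- ⊗_A N` from right `A`-modules to `k`-vector spaces, where `M ⊗_A N` is the
quotient of `M ⊗_k N` by the relations `m a ⊗ n = m ⊗ a n`. -/
noncomputable def tensorRight (N : ModuleCat.{u} A) : ModuleCat.{u} Aᵐᵒᵖ ⥤ ModuleCat.{u} k where
  obj M := ModuleCat.of k ((M ⊗[k] N) ⧸ balanced k M N)
  map f := ModuleCat.ofHom (tensorMap k f (𝟙 N))
  map_id M := by
    ext : 1
    refine Submodule.linearMap_qext _ (TensorProduct.ext' fun m n => ?_)
    rfl
  map_comp f f' := by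
    ext : 1
    refine Submodule.linearMap_qext _ (TensorProduct.ext' fun m n => ?_)
    rfl

instance (N : ModuleCat.{u} A) : (tensorRight k A N).Additive where
  map_add {M M'} f f' := by
    ext : 1
    refine Submodule.linearMap_qext _ (TensorProduct.ext' fun m n => ?_)
    change (balanced k M' N).mkQ ((f.hom m + f'.hom m) ⊗ₜ[k] n) =
      (balanced k M' N).mkQ (f.hom m ⊗ₜ[k] n) + (balanced k M' N).mkQ (f'.hom m ⊗ₜ[k] n)
    rw [TensorProduct.add_tmul, map_add]

/-- Functoriality of `M ⊗_A N` in `N`. -/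
noncomputable def tensorRightMap {N N' : ModuleCat.{u} A} (h : N ⟶ N') :
    tensorRight k A N ⟶ tensorRight k A N' where
  app M := ModuleCat.ofHom (tensorMap k (𝟙 M) h)
  naturality M M' f := by
    ext : 1
    refine Submodule.linearMap_qext _ (TensorProduct.ext' fun m n => ?_)
    rfl

theorem tensorRightMap_id (N : ModuleCat.{u} A) :
    tensorRightMap k A (𝟙 N) = 𝟙 (tensorRight k A N) := by
  ext M : 3
  refine Submodule.linearMap_qext _ (TensorProduct.ext' fun m n => ?_)
  rfl

theorem tensorRightMap_comp {N N' N'' : ModuleCat.{u} A} (h : N ⟶ N') (h' : N' ⟶ N'') :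
    tensorRightMap k A (h ≫ h') = tensorRightMap k A h ≫ tensorRightMap k A h' := by
  ext M : 3
  refine Submodule.linearMap_qext _ (TensorProduct.ext' fun m n => ?_)
  rfl

/-- The bifunctor `(M, N) ↦ Tor^A_n(M, N)` on right `A`-modules and left `A`-modules: the `n`-th
left derived functor of `- ⊗_A N`, evaluated at `M`. -/
noncomputable def Tor (n : ℕ) : ModuleCat.{u} Aᵐᵒᵖ ⥤ ModuleCat.{u} A ⥤ ModuleCat.{u} k :=
  Functor.flip
    { obj := fun N => (tensorRight k A N).leftDerived n
      map := fun h => NatTrans.leftDerived (tensorRightMap k A h) n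
      map_id := fun N => by rw [tensorRightMap_id, NatTrans.leftDerived_id]
      map_comp := fun h h' => by rw [tensorRightMap_comp, NatTrans.leftDerived_comp] }

end NCTor

/-! ### The cap product `Ext^p(X, Y) × Tor_{n+p}(X, N) → Tor_n(Y, N)` -/

namespace NCTor

section

variable {C : Type*} [Category* C] [Abelian C]

/-- The complex `K_{• + p}`, with the differentials of `K` and the terms below degree `p`
discarded. -/
abbrev shiftDown (K : ChainComplex C ℕ) (p : ℕ) : ChainComplex C ℕ where
  X i := K.X (i + p)
  d i j := K.d (i + p) (j + p)
  shape i j h := K.shape _ _ (by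
    simp only [ComplexShape.down_Rel] at h ⊢
    omega)
  d_comp_d' _ _ _ _ _ := K.d_comp_d _ _ _

/-- A cycle of degree `n + p` in `K` is a cycle of degree `n` in `K_{• + p}`; this is the induced
map `H_{n+p}(K) → H_n(K_{• + p})`. -/
noncomputable def homologyShiftDown (K : ChainComplex C ℕ) (p n : ℕ) :
    K.homology (n + p) ⟶ (shiftDown K p).homology n :=
  (K.homologyIsCokernel (n + p + 1) (n + p) (by simp)).desc
    (CokernelCofork.ofπ
      ((shiftDown K p).liftCycles (K.iCycles (n + p)) _ rfl (K.iCycles_d _ _) ≫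
        (shiftDown K p).homologyπ n) (by
        rw [← Category.assoc, HomologicalComplex.comp_liftCycles]
        refine (shiftDown K p).liftCycles_homologyπ_eq_zero_of_boundary _ _ rfl
          (i' := n + 1) (K.XIsoOfEq (show n + p + 1 = n + 1 + p by omega)).hom ?_
        simp))

variable {X Y : C} (P : ProjectiveResolution X) (Q : ProjectiveResolution Y)

/-- The augmentation `Q_0 → Y` of a projective resolution of `Y`. -/
noncomputable def augmentation : Q.complex.X 0 ⟶ Y := Q.π.f 0

instance : Epi (augmentation Q) := inferInstanceAs (Epi (Q.π.f 0))

/-- A cocycle `f : P_p → Y` on a projective resolution `P` of `X` lifts to a chain map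
`P_{• + p} → Q` to a projective resolution `Q` of `Y`. -/
theorem exists_liftCocycle (p : ℕ) (f : P.complex.X p ⟶ Y)
    (hf : P.complex.d (p + 1) p ≫ f = 0) :
    ∃ F : shiftDown P.complex p ⟶ Q.complex,
      F.f 0 ≫ augmentation Q = (P.complex.XIsoOfEq (Nat.zero_add p)).hom ≫ f := by
  have hproj (i : ℕ) : Projective ((shiftDown P.complex p).X i) := P.projective _
  let F0 : P.complex.X (0 + p) ⟶ Q.complex.X 0 :=
    Projective.factorThru ((P.complex.XIsoOfEq (Nat.zero_add p)).hom ≫ f) (augmentation Q)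
  have hF0 : F0 ≫ augmentation Q = (P.complex.XIsoOfEq (Nat.zero_add p)).hom ≫ f :=
    Projective.factorThru_comp _ _
  have h1 : ((shiftDown P.complex p).d 1 0 ≫ F0) ≫ augmentation Q = 0 := by
    rw [Category.assoc, hF0]
    change P.complex.d (1 + p) (0 + p) ≫ _ = 0
    rw [HomologicalComplex.d_comp_XIsoOfEq_hom_assoc, ← P.complex.XIsoOfEq_hom_comp_d
      (Nat.add_comm 1 p), Category.assoc, hf, comp_zero]
  refine ⟨ChainComplex.mkHom _ _ F0 (Q.exact₀.liftFromProjective _ h1)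
    (Q.exact₀.liftFromProjective_comp _ h1) (fun n ⟨a, b, w⟩ =>
      ⟨(Q.exact_succ n).liftFromProjective ((shiftDown P.complex p).d (n + 2) (n + 1) ≫ b) ?_,
        (Q.exact_succ n).liftFromProjective_comp _ _⟩), ?_⟩
  · change (_ ≫ b) ≫ Q.complex.d (n + 1) n = 0
    rw [Category.assoc, w, HomologicalComplex.d_comp_d_assoc, zero_comp]
  · exact hF0

end

section

variable (k : Type u) [Field k] (A : Type u) [Ring A] [Algebra k A]

variable {A}

/-- The map `H_{n+p}(P ⊗_A N) → H_n(Q ⊗_A N)` induced by a chain map `F : P_{• + p} → Q`. -/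
noncomputable def homologyTensorMap (N : ModuleCat.{u} A) {P Q : ChainComplex (ModuleCat.{u} Aᵐᵒᵖ) ℕ}
    {p : ℕ} (F : shiftDown P p ⟶ Q) (n : ℕ) :
    (((tensorRight k A N).mapHomologicalComplex _).obj P).homology (n + p) ⟶
      (((tensorRight k A N).mapHomologicalComplex _).obj Q).homology n :=
  homologyShiftDown (((tensorRight k A N).mapHomologicalComplex _).obj P) p n ≫
    HomologicalComplex.homologyMap
      (((tensorRight k A N).mapHomologicalComplex (ComplexShape.down ℕ)).map F) n

/-- The cap product with a class `e ∈ Ext^p_A(X, Y)`, for right `A`-modules `X` and `Y`, is the map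
`Tor^A_{n+p}(X, N) → Tor^A_n(Y, N)` obtained as follows: represent `e` by a cocycle `P_p → Y` on a
projective resolution `P` of `X`, lift this cocycle to a chain map `P_{• + p} → Q` to a projective
resolution `Q` of `Y`, and apply `H_n(- ⊗_A N)`. (The chain map is unique up to homotopy, and
changing the cocycle by a coboundary does not affect the result.) -/
noncomputable def cap {X Y : ModuleCat.{u} Aᵐᵒᵖ} {p : ℕ} (e : Abelian.Ext.{u} X Y p) (n : ℕ)
    (N : ModuleCat.{u} A) :
    ((Tor k A (n + p)).obj X).obj N ⟶ ((Tor k A n).obj Y).obj N :=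
  let P := projectiveResolution X
  let Q := projectiveResolution Y
  let hcocycle := P.extMk_surjective e (p + 1) rfl
  let hlift := exists_liftCocycle P Q p hcocycle.choose hcocycle.choose_spec.choose
  (P.isoLeftDerivedObj (tensorRight k A N) (n + p)).hom ≫
    homologyTensorMap k N hlift.choose n ≫
      (Q.isoLeftDerivedObj (tensorRight k A N) n).inv

end

end NCTor

/-! ### Right modules over `U(g_Lie)` and `UL(g)` -/

namespace LeibnizAlg

open MulOpposite TensorProduct

open scoped ModuleCat

section

variable {k : Type u} [Field k] {A : Type u} [Ring A] [Algebra k A]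

/-- The right `A`-module given by a `k`-vector space `V` and an algebra morphism
`A → End_k(V)ᵒᵖ`. -/
noncomputable def ofRightRep {V : Type u} [AddCommGroup V] [Module k V]
    (φ : A →ₐ[k] (Module.End k V)ᵐᵒᵖ) : ModuleCat.{u} Aᵐᵒᵖ :=
  letI : Module Aᵐᵒᵖ V := Module.compHom V (AlgHom.opComm φ).toRingHom
  ModuleCat.of Aᵐᵒᵖ V

/-- A morphism of right `A`-modules from an additive map that commutes with the actions. -/
def homMk {X Y : ModuleCat.{u} Aᵐᵒᵖ} (f : X →+ Y)
    (hf : ∀ (a : A) (x : X), f (op a • x) = op a • f x) : X ⟶ Y :=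
  ModuleCat.ofHom { f with map_smul' := fun a x => hf a.unop x }

end

variable (k g : Type u) [Field k] [NonUnitalNonAssocRing g] [Module k g]
  [IsScalarTower k g g] [SMulCommClass k g g] [IsLeibniz g]

/-- Right `g_Lie`-modules, i.e. right `U(g_Lie)`-modules. -/
abbrev RightLieMod : Type (u + 1) := ModuleCat.{u} (U k g)ᵐᵒᵖ

/-- Left `g_Lie`-modules, i.e. left `U(g_Lie)`-modules. -/
abbrev LeftLieMod : Type (u + 1) := ModuleCat.{u} (U k g)

variable {k g}

/-- The right action of `g_Lie` on a right `g_Lie`-module `M`. -/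
noncomputable def act (M : RightLieMod k g) : LieQuot k g →ₗ[k] Module.End k M :=
  (Algebra.lsmul k k (M : Type u)).toLinearMap ∘ₗ (opLinearEquiv k).toLinearMap ∘ₗ ιLie k g

theorem act_apply (M : RightLieMod k g) (y : LieQuot k g) (m : M) :
    act M y m = op (ιLie k g y) • m := rfl

theorem act_lie (M : RightLieMod k g) (x y : LieQuot k g) :
    act M ⁅x, y⁆ = act M y * act M x - act M x * act M y := by
  ext m
  simp only [act_apply, ιLie_lie, LinearMap.sub_apply, Module.End.mul_apply,
    MulOpposite.op_sub, MulOpposite.op_mul, sub_smul, mul_smul]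

theorem gDown_lie (x y : LieQuot k g) :
    gDown k g ⁅x, y⁆ = gDown k g y * gDown k g x - gDown k g x * gDown k g y := by
  obtain ⟨x, rfl⟩ := toLie_surjective k g x
  obtain ⟨y, rfl⟩ := toLie_surjective k g y
  ext z
  simp only [bracket_toLie, LinearMap.sub_apply, Module.End.mul_apply, gDown_toLie]
  exact IsLeibniz.leibniz z x y

/-- The diagonal right action of `g_Lie` on `M ⊗ g↓`: `(m ⊗ x) y = m y ⊗ x + m ⊗ x y`. -/
noncomputable def diag (M : RightLieMod k g) : LieQuot k g →ₗ[k] Module.End k (M ⊗[k] g) :=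
  LinearMap.rTensorHom g ∘ₗ act M + LinearMap.lTensorHom (M : Type u) ∘ₗ gDown k g

theorem diag_tmul (M : RightLieMod k g) (y : LieQuot k g) (m : M) (x : g) :
    diag M y (m ⊗ₜ x) = act M y m ⊗ₜ x + m ⊗ₜ gDown k g y x := rfl

theorem diag_lie (M : RightLieMod k g) (x y : LieQuot k g) :
    diag M ⁅x, y⁆ = diag M y * diag M x - diag M x * diag M y := by
  refine TensorProduct.ext' fun m z => ?_
  simp only [LinearMap.sub_apply, Module.End.mul_apply, diag_tmul, map_add, act_lie, gDown_lie,
    TensorProduct.sub_tmul, TensorProduct.tmul_sub]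
  abel

/-- The algebra morphism `U(g_Lie) → End_k(M ⊗ g)ᵒᵖ` of the diagonal action. -/
noncomputable def diagRep (M : RightLieMod k g) : U k g →ₐ[k] (Module.End k (M ⊗[k] g))ᵐᵒᵖ :=
  liftU ((opLinearEquiv k).toLinearMap ∘ₗ diag M) (fun x y => unop_injective (diag_lie M x y))

theorem diagRep_ιU (M : RightLieMod k g) (y : g) :
    diagRep M (ιU k g y) = op (diag M (toLie k g y)) := liftU_ιU ..

/-- The right `g_Lie`-module `M ⊗ g↓`, with the diagonal action. -/
noncomputable def tensorDownObj (M : RightLieMod k g) : RightLieMod k g := ofRightRep (diagRep M)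

theorem tensorDownMap_aux {M M' : RightLieMod k g} (f : M ⟶ M') (a : U k g) :
    ∀ t : M ⊗[k] g, (f.hom.restrictScalars k).rTensor g ((diagRep M a).unop t) =
      (diagRep M' a).unop ((f.hom.restrictScalars k).rTensor g t) := by
  induction a using U_induction with
  | hc c => intro t; simp [AlgHom.commutes]
  | hι x =>
    intro t
    rw [diagRep_ιU, diagRep_ιU]
    induction t using TensorProduct.induction_on with
    | zero => simp
    | add t t' h h' => simp only [map_add, h, h']
    | tmul m y => simp [diag_tmul, act_apply]
  | hadd a b ha hb => intro t; simp only [map_add, MulOpposite.unop_add, LinearMap.add_apply, ha, hb]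
  | hmul a b ha hb =>
    intro t; simp only [map_mul, MulOpposite.unop_mul, Module.End.mul_apply, ha, hb]

/-- The functor `M ↦ M ⊗ g↓` on right `g_Lie`-modules. -/
noncomputable def tensorDown : RightLieMod k g ⥤ RightLieMod k g where
  obj M := tensorDownObj M
  map {M M'} f := homMk (X := tensorDownObj M) (Y := tensorDownObj M')
    ((f.hom.restrictScalars k).rTensor g : M ⊗[k] g →ₗ[k] M' ⊗[k] g).toAddMonoidHom
    (fun a t => tensorDownMap_aux f a t)
  map_id M := by
    ext t
    exact LinearMap.rTensor_id_apply (R := k) g (M : Type u) t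
  map_comp {M M' M''} f f' := by
    ext t
    exact LinearMap.rTensor_comp_apply (R := k) g (f'.hom.restrictScalars k)
      (f.hom.restrictScalars k) t

/-! ### The extension `lext(M)` -/

/-- The right action of `g` on `lext(M) = (M ⊗ g↓) ⊕ M`: `[t, n] y = [t y, n y]`. -/
noncomputable def lextR (M : RightLieMod k g) : g →ₗ[k] Module.End k ((M ⊗[k] g) × M) :=
  LinearMap.prodMapLinear k (M ⊗[k] g) M (M ⊗[k] g) M k ∘ₗ (diag M).prod (act M) ∘ₗ toLie k g

/-- The left action of `g` on `lext(M) = (M ⊗ g↓) ⊕ M`: `z [t, n] = [n ⊗ z, -n z]`. -/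
noncomputable def lextL (M : RightLieMod k g) : g →ₗ[k] Module.End k ((M ⊗[k] g) × M) where
  toFun z := (((TensorProduct.mk k M g).flip z).prod (-act M (toLie k g z))) ∘ₗ
    LinearMap.snd k (M ⊗[k] g) M
  map_add' z z' := by
    ext t <;> simp [add_comm]
  map_smul' c z := by
    ext t <;> simp

theorem lextR_apply (M : RightLieMod k g) (y : g) (t : M ⊗[k] g) (n : M) :
    lextR M y (t, n) = (diag M (toLie k g y) t, act M (toLie k g y) n) := rfl

theorem lextL_apply (M : RightLieMod k g) (z : g) (t : M ⊗[k] g) (n : M) :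
    lextL M z (t, n) = (n ⊗ₜ z, -act M (toLie k g z) n) := rfl

/-- The algebra morphism `UL(g) → End_k((M ⊗ g) ⊕ M)ᵒᵖ` defining the `g`-module `lext(M)`; in a
right `UL(g)`-module, `r_x` is the right action of `x` and `l_x` is the left action of `x`. -/
noncomputable def lextRep (M : RightLieMod k g) :
    UL k g →ₐ[k] (Module.End k ((M ⊗[k] g) × M))ᵐᵒᵖ :=
  liftUL ((opLinearEquiv k).toLinearMap ∘ₗ lextL M) ((opLinearEquiv k).toLinearMap ∘ₗ lextR M)
    (by
      intro x y
      apply unop_injective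
      change lextR M (x * y) = lextR M y * lextR M x - lextR M x * lextR M y
      refine LinearMap.ext fun ⟨t, n⟩ => ?_
      simp only [LinearMap.sub_apply, Module.End.mul_apply, lextR_apply, ← bracket_toLie,
        diag_lie, act_lie, Prod.mk_sub_mk])
    (by
      intro x y
      apply unop_injective
      change lextL M (x * y) = lextR M y * lextL M x - lextL M x * lextR M y
      refine LinearMap.ext fun ⟨t, n⟩ => ?_
      simp only [LinearMap.sub_apply, Module.End.mul_apply, lextR_apply, lextL_apply,
        ← bracket_toLie, diag_tmul, act_lie, Prod.mk_sub_mk, gDown_toLie, map_neg]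
      refine Prod.ext ?_ ?_ <;> simp only <;> abel)
    (by
      intro x y
      apply unop_injective
      change lextL M y * (lextR M x + lextL M x) = 0
      refine LinearMap.ext fun ⟨t, n⟩ => ?_
      simp only [LinearMap.add_apply, Module.End.mul_apply, lextR_apply, lextL_apply,
        Prod.mk_add_mk, add_neg_cancel, TensorProduct.zero_tmul, map_zero, neg_zero]
      rfl)

theorem lextRep_lGen (M : RightLieMod k g) (x : g) :
    lextRep M (lGen k g x) = op (lextL M x) := liftUL_lGen ..

theorem lextRep_rGen (M : RightLieMod k g) (x : g) :
    lextRep M (rGen k g x) = op (lextR M x) := liftUL_rGen ..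

variable (k g) in
/-- Modules over the Leibniz algebra `g`, i.e. right `UL(g)`-modules. -/
abbrev LeibMod : Type (u + 1) := ModuleCat.{u} (UL k g)ᵐᵒᵖ

/-- The `g`-module `lext(M)`. -/
noncomputable def lext (M : RightLieMod k g) : LeibMod k g := ofRightRep (lextRep M)

variable (k g)

/-- The restriction functor `M ↦ M^{d₀}` on right modules. -/
noncomputable abbrev resR₀ : RightLieMod k g ⥤ LeibMod k g :=
  ModuleCat.restrictScalars (AlgHom.op (d₀ k g)).toRingHom

/-- The restriction functor `M ↦ M^{d₁}` on right modules. -/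
noncomputable abbrev resR₁ : RightLieMod k g ⥤ LeibMod k g :=
  ModuleCat.restrictScalars (AlgHom.op (d₁ k g)).toRingHom

/-- The restriction functor `N ↦ ^{d₁}N` on left modules. -/
noncomputable abbrev resL₁ : LeftLieMod k g ⥤ ModuleCat.{u} (UL k g) :=
  ModuleCat.restrictScalars (d₁ k g).toRingHom

variable {k g}

theorem lextInl_aux (M : RightLieMod k g) (a : UL k g) : ∀ t : M ⊗[k] g,
    ((diagRep M (d₀ k g a)).unop t, (0 : M)) = (lextRep M a).unop (t, 0) := by
  induction a using UL_induction with
  | hc c => intro t; simp [AlgHom.commutes]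
  | hl x => intro t; rw [d₀_lGen, lextRep_lGen]; simp [lextL_apply]
  | hr x => intro t; rw [d₀_rGen, lextRep_rGen, diagRep_ιU]; simp [lextR_apply]
  | hadd a b ha hb =>
    intro t
    simp only [map_add, MulOpposite.unop_add, LinearMap.add_apply, ← ha, ← hb, Prod.mk_add_mk,
      add_zero]
  | hmul a b ha hb =>
    intro t
    simp only [map_mul, MulOpposite.unop_mul, Module.End.mul_apply, ← ha, ← hb]

theorem lextSnd_aux (M : RightLieMod k g) (a : UL k g) : ∀ v : (M ⊗[k] g) × M,
    ((lextRep M a).unop v).2 = op (d₁ k g a) • v.2 := by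
  induction a using UL_induction with
  | hc c =>
    intro v
    rw [AlgHom.commutes, AlgHom.commutes]
    change c • v.2 = _
    exact (algebraMap_smul (U k g)ᵐᵒᵖ c v.2).symm
  | hl x =>
    rintro ⟨t, n⟩
    rw [d₁_lGen, lextRep_lGen, MulOpposite.op_neg, neg_smul]
    rfl
  | hr x =>
    rintro ⟨t, n⟩
    rw [d₁_rGen, lextRep_rGen]
    rfl
  | hadd a b ha hb =>
    intro v
    simp only [map_add, MulOpposite.unop_add, LinearMap.add_apply, Prod.snd_add, ha, hb,
      MulOpposite.op_add, add_smul]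
  | hmul a b ha hb =>
    intro v
    simp only [map_mul, MulOpposite.unop_mul, Module.End.mul_apply, ha, hb, MulOpposite.op_mul,
      mul_smul]

/-- The inclusion `(M ⊗ g↓)^{d₀} → lext(M)`, `t ↦ [t, 0]`. -/
noncomputable def lextInl (M : RightLieMod k g) :
    (resR₀ k g).obj (tensorDown.obj M) ⟶ lext M :=
  homMk (X := (resR₀ k g).obj (tensorDown.obj M)) (Y := lext M)
    (LinearMap.inl k (M ⊗[k] g) M).toAddMonoidHom (fun a t => lextInl_aux M a t)

/-- The projection `lext(M) → M^{d₁}`, `[t, n] ↦ n`. -/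
noncomputable def lextSnd (M : RightLieMod k g) : lext M ⟶ (resR₁ k g).obj M :=
  homMk (X := lext M) (Y := (resR₁ k g).obj M)
    (LinearMap.snd k (M ⊗[k] g) M).toAddMonoidHom (fun a v => lextSnd_aux M a v)

/-- The sequence `(M ⊗ g↓)^{d₀} → lext(M) → M^{d₁}`. -/
noncomputable def lextSeq (M : RightLieMod k g) : ShortComplex (LeibMod k g) where
  X₁ := (resR₀ k g).obj (tensorDown.obj M)
  X₂ := lext M
  X₃ := (resR₁ k g).obj M
  f := lextInl M
  g := lextSnd M
  zero := by ext t; rfl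

theorem lextSeq_shortExact (M : RightLieMod k g) : (lextSeq M).ShortExact where
  exact := by
    rw [ShortComplex.moduleCat_exact_iff]
    rintro ⟨t, n⟩ h
    exact ⟨t, Prod.ext rfl h.symm⟩
  mono_f := (ModuleCat.mono_iff_injective _).2 fun t t' h => congrArg Prod.fst h
  epi_g := (ModuleCat.epi_iff_surjective _).2 fun n => ⟨(0, n), rfl⟩

/-- The class `[lext(M)] ∈ Ext¹(M^{d₁}, (M ⊗ g↓)^{d₀})` of the extension `lext(M)`. -/
noncomputable def lextClass (M : RightLieMod k g) :
    Abelian.Ext.{u} ((resR₁ k g).obj M) ((resR₀ k g).obj (tensorDown.obj M)) 1 :=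
  (lextSeq_shortExact M).extClass

/-! ### The bifunctors in the splitting -/

variable (k g)

/-- The bifunctor `(M, N) ↦ Tor^{UL(g)}_n(M^{d₁}, ^{d₁}N)`. -/
noncomputable def torSym (n : ℕ) : RightLieMod k g ⥤ LeftLieMod k g ⥤ ModuleCat.{u} k :=
  resR₁ k g ⋙ NCTor.Tor k (UL k g) n ⋙ (Functor.whiskeringLeft _ _ _).obj (resL₁ k g)

/-- The bifunctor `(M, N) ↦ Tor^{U(g_Lie)}_n(M, N)`. -/
noncomputable def torLie (n : ℕ) : RightLieMod k g ⥤ LeftLieMod k g ⥤ ModuleCat.{u} k :=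
  NCTor.Tor k (U k g) n

/-- The bifunctor `(M, N) ↦ Tor^{UL(g)}_{n-1}((M ⊗ g↓)^{d₀}, ^{d₁}N)`, which is zero for
`n = 0`. -/
noncomputable def torDown : ℕ → (RightLieMod k g ⥤ LeftLieMod k g ⥤ ModuleCat.{u} k)
  | 0 => (Functor.const _).obj ((Functor.const _).obj (ModuleCat.of k PUnit))
  | n + 1 => tensorDown ⋙ resR₀ k g ⋙ NCTor.Tor k (UL k g) n ⋙
      (Functor.whiskeringLeft _ _ _).obj (resL₁ k g)

/-- The cap product with `[lext(M)]`, as a map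
`Tor^{UL(g)}_n(M^{d₁}, ^{d₁}N) → Tor^{UL(g)}_{n-1}((M ⊗ g↓)^{d₀}, ^{d₁}N)`. -/
noncomputable def capLext : (n : ℕ) → (M : RightLieMod k g) → (N : LeftLieMod k g) →
    (((torSym k g n).obj M).obj N ⟶ ((torDown k g n).obj M).obj N)
  | 0, _, _ => 0
  | n + 1, M, N => NCTor.cap k (lextClass M) n ((resL₁ k g).obj N)

end LeibnizAlg

/-! Write s for the section `sU` : U(g_Lie) → UL(g) of d₁ sending x̄ to r_x. The module lext(M) is
the extension of scalars of M along s: it is generated by the elements [0, m], because [m ⊗ x, 0] =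
[0, m](l_x + r_x), and the relations of UL(g) let every U(g_Lie)-linear map from M to a restricted
UL(g)-module extend to lext(M). The functor `lextFunctor` therefore preserves projectives, and it is
exact because tensoring over a field is. Moreover d₁ kills l_x + r_x and d₁ s = id, so lext(M)
⊗_{UL(g)} N = M ⊗_{U(g_Lie)} N for a left module N restricted along d₁. Resolving M and applying
`lextFunctor` gives Tor^{UL(g)}_n(lext(M), N) ≅ Tor^{U(g_Lie)}_n(M, N).

This isomorphism factors as the map induced by lext(M) → M^{d₁} followed by the comparison map
Tor^{UL(g)}_n(M^{d₁}, N) → Tor^{U(g_Lie)}_n(M, N) (`isIso_leftDerived_map_lextSnd_comp_comparison`).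
Hence the first map is a split monomorphism, the long exact Tor sequence of lext(M) breaks into
split short exact sequences, and the pair (comparison, cap product) is an isomorphism
(`isIso_of_biproduct`).

It remains to put the cap product in the place of the connecting map. The long exact sequence comes
from a resolution of lext(M) glued from resolutions of its outer terms; its connecting map is, up to
sign, induced by a cocycle f whose image in Ext¹(M^{d₁}, lext(M)) vanishes. Exactness of the Ext
sequence says only that the class of f is [lext(M)] precomposed with some endomorphism v of M^{d₁}.
There is no need to compute v: restriction along d₁ is full, so v comes from some w : M → M, and
naturality of [lext(M)] in M yields two descriptions of the connecting map, w followed by the cap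
product and the cap product followed by w. The first makes the cap product surjective
(`cap_lextClass_surjective`); the second puts its kernel inside that of the connecting map
(`exists_of_cap_lextClass_eq_zero`). -/

/-! ### Comparison of resolutions -/

namespace NCTor

section

variable {C : Type*} [Category* C] [Abelian C]

/-- `ε : Q₀ → Z` exhibits the chain complex `Q` as a left resolution of `Z`. -/
structure IsLeftResolution (Q : ChainComplex C ℕ) {Z : C} (ε : Q.X 0 ⟶ Z) : Prop where
  d_comp : Q.d 1 0 ≫ ε = 0
  epi : Epi ε
  exact₀ : (ShortComplex.mk _ _ d_comp).Exact
  exact_succ (n : ℕ) : (ShortComplex.mk _ _ (Q.d_comp_d (n + 2) (n + 1) n)).Exact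

theorem isLeftResolution_of_projectiveResolution {Z : C} (P : ProjectiveResolution Z) :
    IsLeftResolution P.complex (augmentation P) where
  d_comp := P.complex_d_comp_π_f_zero
  epi := inferInstance
  exact₀ := P.exact₀
  exact_succ := P.exact_succ

namespace IsLeftResolution

variable {K Q : ChainComplex C ℕ} {Z : C} {ε : Q.X 0 ⟶ Z}

/-- This is the reason for resolutions by arbitrary objects: restriction along d₁ is exact but need
not preserve projectives. -/
theorem map {D : Type*} [Category* D] [Abelian D] (R : C ⥤ D) [R.Additive]
    [R.PreservesHomology] (h : IsLeftResolution Q ε) :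
    IsLeftResolution ((R.mapHomologicalComplex _).obj Q) (R.map ε) where
  d_comp := (R.map_comp _ _).symm.trans (by rw [h.d_comp, R.map_zero]; rfl)
  epi := by
    have := h.epi
    exact inferInstanceAs (@Epi D _ (R.obj (Q.X 0)) (R.obj Z) (R.map ε))
  exact₀ := h.exact₀.map R
  exact_succ n := (h.exact_succ n).map R

theorem exists_lift (h : IsLeftResolution Q ε) (hK : ∀ n, Projective (K.X n))
    (f : K.X 0 ⟶ Z) (hf : K.d 1 0 ≫ f = 0) : ∃ F : K ⟶ Q, F.f 0 ≫ ε = f := by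
  have := h.epi
  have h1 : (K.d 1 0 ≫ Projective.factorThru f ε) ≫ ε = 0 := by simp [hf]
  refine ⟨ChainComplex.mkHom _ _ (Projective.factorThru f ε) (h.exact₀.liftFromProjective _ h1)
    (h.exact₀.liftFromProjective_comp _ h1) (fun n ⟨a, b, w⟩ =>
      ⟨(h.exact_succ n).liftFromProjective (K.d (n + 2) (n + 1) ≫ b) ?_,
        (h.exact_succ n).liftFromProjective_comp _ _⟩), Projective.factorThru_comp _ _⟩
  change (_ ≫ b) ≫ Q.d (n + 1) n = 0
  rw [Category.assoc, w, HomologicalComplex.d_comp_d_assoc, zero_comp]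

theorem homotopy_zero (h : IsLeftResolution Q ε) (hK : ∀ n, Projective (K.X n))
    (F : K ⟶ Q) (hF : F.f 0 ≫ ε = 0) : Nonempty (Homotopy F 0) := by
  -- `z` and `o` are the homotopy in degrees 0 and 1; all higher components come from one recursion.
  let z := h.exact₀.liftFromProjective (F.f 0) hF
  have hz : z ≫ Q.d 1 0 = F.f 0 := h.exact₀.liftFromProjective_comp _ _
  have h1 : (F.f 1 - K.d 1 0 ≫ z) ≫ Q.d 1 0 = 0 := by simp [hz]
  let o := (h.exact_succ 0).liftFromProjective _ h1
  have ho : o ≫ Q.d 2 1 = F.f 1 - K.d 1 0 ≫ z := (h.exact_succ 0).liftFromProjective_comp _ _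
  refine ⟨Homotopy.mkInductive F z hz.symm o (by rw [ho]; abel) fun n ⟨g, g', w⟩ =>
    ⟨(h.exact_succ (n + 1)).liftFromProjective (F.f (n + 2) - K.d _ _ ≫ g') ?_, ?_⟩⟩
  · change (_ - _ ≫ g') ≫ Q.d (n + 2) (n + 1) = 0
    simp [w]
  · have := (h.exact_succ (n + 1)).liftFromProjective_comp (F.f (n + 2) - K.d _ _ ≫ g') (by
      change (_ - _ ≫ g') ≫ Q.d (n + 2) (n + 1) = 0
      simp [w])
    change _ = _ + _ ≫ Q.d (n + 3) (n + 2)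
    rw [this]; abel

theorem homotopy (h : IsLeftResolution Q ε) (hK : ∀ n, Projective (K.X n))
    (F G : K ⟶ Q) (hF : F.f 0 ≫ ε = G.f 0 ≫ ε) : Nonempty (Homotopy F G) :=
  (h.homotopy_zero hK (F - G) (by simp [hF])).map fun H => Homotopy.equivSubZero.symm H

/-- A left resolution by projective objects is a projective resolution. -/
noncomputable def toProjectiveResolution (h : IsLeftResolution Q ε)
    (hQ : ∀ n, Projective (Q.X n)) : ProjectiveResolution Z where
  complex := Q
  projective := hQ
  π := (ChainComplex.toSingle₀Equiv _ _).symm ⟨ε, h.d_comp⟩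
  quasiIso := ⟨fun n => by
    cases n
    · rw [ChainComplex.quasiIsoAt₀_iff, ShortComplex.quasiIso_iff_of_zeros']
      · have := h.epi
        refine (ShortComplex.exact_and_epi_g_iff_of_iso ?_).2 ⟨h.exact₀, this⟩
        exact ShortComplex.isoMk (Iso.refl _) (Iso.refl _) (Iso.refl _)
          ((Category.id_comp _).trans (Category.comp_id _).symm)
          ((Category.id_comp _).trans ((ChainComplex.toSingle₀Equiv_symm_apply_f_zero ε
            h.d_comp).symm.trans (Category.comp_id _).symm))
      · exact Q.shape _ _ (by simp)
      all_goals rfl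
    · rw [quasiIsoAt_iff_exactAt']
      · exact (HomologicalComplex.exactAt_iff' _ (_ + 2) (_ + 1) _
          (by simp only [ChainComplex.prev]; rfl) (by simp)).2 <| h.exact_succ _
      · apply ChainComplex.exactAt_succ_single_obj⟩

theorem toProjectiveResolution_augmentation (h : IsLeftResolution Q ε)
    (hQ : ∀ n, Projective (Q.X n)) :
    augmentation (h.toProjectiveResolution hQ) = ε := by
  simp [augmentation, toProjectiveResolution]

end IsLeftResolution

end

end NCTor

/-! ### Maps of homology of degree `-p` induced by chain maps `P_{• + p} → Q` -/

namespace NCTor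

section

variable {C : Type*} [Category* C] [Abelian C]

/-- A chain map `K → L` induces a chain map `K_{• + p} → L_{• + p}`. -/
abbrev shiftDownMap {K L : ChainComplex C ℕ} (φ : K ⟶ L) (p : ℕ) :
    shiftDown K p ⟶ shiftDown L p where
  f i := φ.f (i + p)
  comm' _ _ _ := φ.comm _ _

theorem homologyπ_comp_homologyShiftDown (K : ChainComplex C ℕ) (p n : ℕ) :
    K.homologyπ (n + p) ≫ homologyShiftDown K p n =
      (shiftDown K p).liftCycles (K.iCycles (n + p)) _ rfl (K.iCycles_d _ _) ≫
        (shiftDown K p).homologyπ n :=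
  (K.homologyIsCokernel (n + p + 1) (n + p) (by simp)).fac _ WalkingParallelPair.one

theorem homologyπ_comp_homologyShiftDown_assoc (K : ChainComplex C ℕ) (p n : ℕ) {Z : C}
    (h : (shiftDown K p).homology n ⟶ Z) :
    K.homologyπ (n + p) ≫ homologyShiftDown K p n ≫ h =
      (shiftDown K p).liftCycles (K.iCycles (n + p)) _ rfl (K.iCycles_d _ _) ≫
        (shiftDown K p).homologyπ n ≫ h := by
  rw [← Category.assoc, homologyπ_comp_homologyShiftDown, Category.assoc]

theorem homologyShiftDown_naturality {K L : ChainComplex C ℕ} (φ : K ⟶ L) (p n : ℕ) :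
    HomologicalComplex.homologyMap φ (n + p) ≫ homologyShiftDown L p n =
      homologyShiftDown K p n ≫ HomologicalComplex.homologyMap (shiftDownMap φ p) n := by
  rw [← cancel_epi (K.homologyπ (n + p)), HomologicalComplex.homologyπ_naturality_assoc,
    homologyπ_comp_homologyShiftDown, homologyπ_comp_homologyShiftDown_assoc,
    HomologicalComplex.homologyπ_naturality, ← Category.assoc, ← Category.assoc]
  congr 1
  rw [← cancel_mono ((shiftDown L p).iCycles n)]
  simp

theorem homologyShiftDown_naturality_assoc {K L : ChainComplex C ℕ} (φ : K ⟶ L) (p n : ℕ) {Z : C}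
    (h : (shiftDown L p).homology n ⟶ Z) :
    HomologicalComplex.homologyMap φ (n + p) ≫ homologyShiftDown L p n ≫ h =
      homologyShiftDown K p n ≫ HomologicalComplex.homologyMap (shiftDownMap φ p) n ≫ h := by
  rw [← Category.assoc, homologyShiftDown_naturality, Category.assoc]

/-- The map `H_{n+p}(K) → H_n(L)` induced by a chain map `K_{• + p} → L`. -/
noncomputable def homologyShift {K L : ChainComplex C ℕ} {p : ℕ} (G : shiftDown K p ⟶ L) (n : ℕ) :
    K.homology (n + p) ⟶ L.homology n :=
  homologyShiftDown K p n ≫ HomologicalComplex.homologyMap G n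

section

variable {K K' L L' : ChainComplex C ℕ} {p : ℕ}

theorem homologyShift_comp (G : shiftDown K p ⟶ L) (ψ : L ⟶ L') (n : ℕ) :
    homologyShift G n ≫ HomologicalComplex.homologyMap ψ n = homologyShift (G ≫ ψ) n := by
  simp only [homologyShift, HomologicalComplex.homologyMap_comp, Category.assoc]

theorem comp_homologyShift (φ : K' ⟶ K) (G : shiftDown K p ⟶ L) (n : ℕ) :
    HomologicalComplex.homologyMap φ (n + p) ≫ homologyShift G n =
      homologyShift (shiftDownMap φ p ≫ G) n := by
  simp only [homologyShift, HomologicalComplex.homologyMap_comp,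
    homologyShiftDown_naturality_assoc]

theorem homologyShift_sub (F G : shiftDown K p ⟶ L) (n : ℕ) :
    homologyShift (F - G) n = homologyShift F n - homologyShift G n := by
  simp only [homologyShift, HomologicalComplex.homologyMap_sub, Preadditive.comp_sub]

/-- On cycles the map is just G; in this form it can be compared with a connecting map. -/
theorem homologyπ_comp_homologyShift (G : shiftDown K p ⟶ L) (n m : ℕ)
    (hm : (ComplexShape.down ℕ).next n = m) :
    K.homologyπ (n + p) ≫ homologyShift G n =
      L.liftCycles (K.iCycles (n + p) ≫ G.f n) m hm (by
        rw [Category.assoc, G.comm]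
        exact (K.iCycles_d_assoc _ _ _).trans zero_comp) ≫ L.homologyπ n := by
  rw [homologyShift, homologyπ_comp_homologyShiftDown_assoc,
    HomologicalComplex.homologyπ_naturality, ← Category.assoc]
  congr 1
  rw [← cancel_mono (L.iCycles n)]
  simp

/-- G has to vanish only on the cycles of K, which in degree p are fewer than those of `shiftDown K
p` in degree 0. A map G that is not null-homotopic can therefore induce zero. -/
theorem homologyShift_eq_zero (G : shiftDown K p ⟶ L) (n : ℕ)
    (h : K.iCycles (n + p) ≫ G.f n = 0) : homologyShift G n = 0 := by
  rw [← cancel_epi (K.homologyπ (n + p)), homologyπ_comp_homologyShift G n _ rfl, comp_zero]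
  convert zero_comp
  rw [← cancel_mono (L.iCycles n)]
  simp [h]

end

variable {D : Type*} [Category* D] [Abelian D] (T : C ⥤ D) [T.Additive]

/-- The chain map `(T P)_{• + p} → T Q` obtained from `F : P_{• + p} → Q`. -/
noncomputable def mapShift {P Q : ChainComplex C ℕ} {p : ℕ} (F : shiftDown P p ⟶ Q) :
    shiftDown ((T.mapHomologicalComplex _).obj P) p ⟶ (T.mapHomologicalComplex _).obj Q :=
  (T.mapHomologicalComplex (ComplexShape.down ℕ)).map F

/-- The map `H_{n+p}(T P) → H_n(T Q)` induced by a chain map `F : P_{• + p} → Q`. -/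
noncomputable def shiftedHomologyMap {P Q : ChainComplex C ℕ} {p : ℕ} (F : shiftDown P p ⟶ Q)
    (n : ℕ) :
    ((T.mapHomologicalComplex _).obj P).homology (n + p) ⟶
      ((T.mapHomologicalComplex _).obj Q).homology n :=
  homologyShift (mapShift T F) n

section

variable {P P' Q Q' : ChainComplex C ℕ} {p : ℕ}

theorem shiftedHomologyMap_comp (F : shiftDown P p ⟶ Q) (ψ : Q ⟶ Q') (n : ℕ) :
    shiftedHomologyMap T F n ≫
      HomologicalComplex.homologyMap ((T.mapHomologicalComplex _).map ψ) n =
        shiftedHomologyMap T (F ≫ ψ) n :=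
  (homologyShift_comp _ _ _).trans (congrArg (fun G => homologyShift G n)
    ((T.mapHomologicalComplex (ComplexShape.down ℕ)).map_comp F ψ).symm)

theorem comp_shiftedHomologyMap (φ : P' ⟶ P) (F : shiftDown P p ⟶ Q) (n : ℕ) :
    HomologicalComplex.homologyMap ((T.mapHomologicalComplex _).map φ) (n + p) ≫
      shiftedHomologyMap T F n = shiftedHomologyMap T (shiftDownMap φ p ≫ F) n :=
  (comp_homologyShift _ _ _).trans (congrArg (fun G => homologyShift G n)
    ((T.mapHomologicalComplex (ComplexShape.down ℕ)).map_comp (shiftDownMap φ p) F).symm)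

theorem shiftedHomologyMap_sub (F G : shiftDown P p ⟶ Q) (n : ℕ) :
    shiftedHomologyMap T (F - G) n = shiftedHomologyMap T F n - shiftedHomologyMap T G n :=
  (congrArg (fun G => homologyShift G n)
    ((T.mapHomologicalComplex (ComplexShape.down ℕ)).map_sub)).trans (homologyShift_sub _ _ _)

theorem shiftedHomologyMap_eq_of_homotopy {F G : shiftDown P p ⟶ Q} (H : Homotopy F G) (n : ℕ) :
    shiftedHomologyMap T F n = shiftedHomologyMap T G n :=
  congrArg (homologyShiftDown ((T.mapHomologicalComplex _).obj P) p n ≫ ·)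
    ((T.mapHomotopy H).homologyMap_eq n)

theorem shiftedHomologyMap_natural {T T' : C ⥤ D} [T.Additive] [T'.Additive] (α : T ⟶ T')
    (F : shiftDown P p ⟶ Q) (n : ℕ) :
    shiftedHomologyMap T F n ≫ HomologicalComplex.homologyMap
      ((NatTrans.mapHomologicalComplex α _).app Q) n =
    HomologicalComplex.homologyMap ((NatTrans.mapHomologicalComplex α _).app P) (n + p) ≫
      shiftedHomologyMap T' F n :=
  (homologyShift_comp _ _ _).trans ((congrArg (fun G => homologyShift G n)
    ((NatTrans.mapHomologicalComplex α (ComplexShape.down ℕ)).naturality F)).trans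
      (comp_homologyShift _ _ _).symm)

end

section

variable {P Q : ChainComplex C ℕ} {Z : C} {ε : Q.X 0 ⟶ Z}

/-- The chain map `P_{• + 1} → Q` concentrated in degree `0`, given there by `d` followed by
`h : P₀ → Q₀`. -/
def coboundaryMap (h : P.X 0 ⟶ Q.X 0) : shiftDown P 1 ⟶ Q where
  f
    | 0 => P.d 1 0 ≫ h
    | _ + 1 => 0
  comm' i j hij := by
    obtain rfl : j + 1 = i := hij
    cases j with
    | zero =>
      change 0 ≫ _ = P.d 2 1 ≫ P.d 1 0 ≫ h
      simp
    | succ j => exact zero_comp.trans comp_zero.symm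

/-- Only degree 0 matters. There the source is H₁(T P), whose cycles are killed by the differential
P₁ → P₀ through which the map factors, even though `shiftDown` has discarded P₀. -/
theorem shiftedHomologyMap_coboundaryMap (h : P.X 0 ⟶ Q.X 0) (n : ℕ) :
    shiftedHomologyMap T (coboundaryMap h) n = 0 := by
  apply homologyShift_eq_zero
  cases n with
  | zero =>
    have e : (mapShift T (coboundaryMap h)).f 0 =
        ((T.mapHomologicalComplex (ComplexShape.down ℕ)).obj P).d 1 0 ≫ T.map h :=
      T.map_comp _ _
    rw [e]
    exact (HomologicalComplex.iCycles_d_assoc _ _ _ _).trans zero_comp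
  | succ n =>
    have e : (mapShift T (coboundaryMap h)).f (n + 1) = 0 := T.map_zero _ _
    rw [e, comp_zero]

/-- Chain maps `P_{• + 1} → Q` whose augmentations differ by a coboundary induce the same map. -/
theorem shiftedHomologyMap_eq_of_coboundary (hQ : IsLeftResolution Q ε)
    (hP : ∀ n, Projective (P.X n)) (F G : shiftDown P 1 ⟶ Q) (h : P.X 0 ⟶ Z)
    (hFG : F.f 0 ≫ ε - G.f 0 ≫ ε = P.d (0 + 1) 0 ≫ h) (n : ℕ) :
    shiftedHomologyMap T F n = shiftedHomologyMap T G n := by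
  have := hQ.epi
  have := hP 0
  -- Lifting `h` through ε turns the coboundary into a `coboundaryMap`. It has the same augmentation
  -- as F - G, hence is homotopic to it.
  obtain ⟨H⟩ := hQ.homotopy (K := shiftDown P 1) (fun n => hP (n + 1)) (F - G)
    (coboundaryMap (Projective.factorThru h ε)) (by
      change (F.f 0 - G.f 0) ≫ ε = (P.d 1 0 ≫ _) ≫ ε
      rw [Preadditive.sub_comp, hFG, Category.assoc, Projective.factorThru_comp])
  have := shiftedHomologyMap_eq_of_homotopy T H n
  rwa [shiftedHomologyMap_sub, shiftedHomologyMap_coboundaryMap, sub_eq_zero] at this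

end

/-! ### The cap product with a class of degree one -/

section

variable [HasProjectiveResolutions C] {X Y : C}

/-- The value of a left derived functor, computed by a projective resolution. -/
noncomputable def derivedIso (P : ProjectiveResolution X) (n : ℕ) :
    (T.leftDerived n).obj X ≅ ((T.mapHomologicalComplex _).obj P.complex).homology n :=
  P.isoLeftDerivedObj T n

theorem derivedIso_hom_naturality (P : ProjectiveResolution X) (Q : ProjectiveResolution Y)
    (a : X ⟶ Y) (ψ : P.complex ⟶ Q.complex)
    (hψ : ψ.f 0 ≫ augmentation Q = augmentation P ≫ a) (n : ℕ) :
    (T.leftDerived n).map a ≫ (derivedIso T Q n).hom = (derivedIso T P n).hom ≫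
      HomologicalComplex.homologyMap ((T.mapHomologicalComplex _).map ψ) n :=
  ProjectiveResolution.isoLeftDerivedObj_hom_naturality a P Q ψ hψ T n

theorem derivedIso_hom_naturality_assoc (P : ProjectiveResolution X) (Q : ProjectiveResolution Y)
    (a : X ⟶ Y) (ψ : P.complex ⟶ Q.complex)
    (hψ : ψ.f 0 ≫ augmentation Q = augmentation P ≫ a) (n : ℕ) {Z : D}
    (h : ((T.mapHomologicalComplex _).obj Q.complex).homology n ⟶ Z) :
    (T.leftDerived n).map a ≫ (derivedIso T Q n).hom ≫ h = (derivedIso T P n).hom ≫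
      HomologicalComplex.homologyMap ((T.mapHomologicalComplex _).map ψ) n ≫ h := by
  rw [← Category.assoc, derivedIso_hom_naturality T P Q a ψ hψ n, Category.assoc]

theorem derivedIso_inv_naturality (P : ProjectiveResolution X) (Q : ProjectiveResolution Y)
    (a : X ⟶ Y) (ψ : P.complex ⟶ Q.complex)
    (hψ : ψ.f 0 ≫ augmentation Q = augmentation P ≫ a) (n : ℕ) :
    (derivedIso T P n).inv ≫ (T.leftDerived n).map a =
      HomologicalComplex.homologyMap ((T.mapHomologicalComplex _).map ψ) n ≫
        (derivedIso T Q n).inv :=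
  ProjectiveResolution.isoLeftDerivedObj_inv_naturality a P Q ψ hψ T n

theorem leftDerived_app_eq_derivedIso {T T' : C ⥤ D} [T.Additive] [T'.Additive] (α : T ⟶ T')
    (P : ProjectiveResolution X) (n : ℕ) :
    (NatTrans.leftDerived α n).app X = (derivedIso T P n).hom ≫
      HomologicalComplex.homologyMap ((NatTrans.mapHomologicalComplex α _).app P.complex) n ≫
        (derivedIso T' P n).inv :=
  P.leftDerived_app_eq α n

/-- The map of left derived functors of degree `-p` induced by a chain map `P_{• + p} → Q` of
projective resolutions. -/
noncomputable def derivedShift (P : ProjectiveResolution X) (Q : ProjectiveResolution Y) {p : ℕ}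
    (F : shiftDown P.complex p ⟶ Q.complex) (n : ℕ) :
    (T.leftDerived (n + p)).obj X ⟶ (T.leftDerived n).obj Y :=
  (derivedIso T P (n + p)).hom ≫ shiftedHomologyMap T F n ≫ (derivedIso T Q n).inv

theorem derivedShift_comp (P : ProjectiveResolution X) (Q : ProjectiveResolution Y) {p : ℕ}
    (F : shiftDown P.complex p ⟶ Q.complex) (n : ℕ) {Y' : C} (Q' : ProjectiveResolution Y')
    (a : Y ⟶ Y') (ψ : Q.complex ⟶ Q'.complex)
    (hψ : ψ.f 0 ≫ augmentation Q' = augmentation Q ≫ a) :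
    derivedShift T P Q F n ≫ (T.leftDerived n).map a = derivedShift T P Q' (F ≫ ψ) n := by
  simp only [derivedShift, Category.assoc, derivedIso_inv_naturality T Q Q' a ψ hψ n,
    ← shiftedHomologyMap_comp]

theorem comp_derivedShift (P : ProjectiveResolution X) (Q : ProjectiveResolution Y) {p : ℕ}
    (F : shiftDown P.complex p ⟶ Q.complex) (n : ℕ) {X' : C} (P' : ProjectiveResolution X')
    (b : X' ⟶ X) (φ : P'.complex ⟶ P.complex)
    (hφ : φ.f 0 ≫ augmentation P = augmentation P' ≫ b) :
    (T.leftDerived (n + p)).map b ≫ derivedShift T P Q F n =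
      derivedShift T P' Q (shiftDownMap φ p ≫ F) n := by
  simp only [derivedShift, derivedIso_hom_naturality_assoc T P' P b φ hφ (n + p),
    ← comp_shiftedHomologyMap, Category.assoc]

theorem derivedShift_natural {T T' : C ⥤ D} [T.Additive] [T'.Additive] (α : T ⟶ T')
    (P : ProjectiveResolution X) (Q : ProjectiveResolution Y) {p : ℕ}
    (F : shiftDown P.complex p ⟶ Q.complex) (n : ℕ) :
    derivedShift T P Q F n ≫ (NatTrans.leftDerived α n).app Y =
      (NatTrans.leftDerived α (n + p)).app X ≫ derivedShift T' P Q F n := by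
  simp only [leftDerived_app_eq_derivedIso α P, leftDerived_app_eq_derivedIso α Q, derivedShift,
    Category.assoc, Iso.inv_hom_id_assoc, reassoc_of% (shiftedHomologyMap_natural α F n)]

variable [HasExt.{u} C]

theorem exists_coboundary_of_extMk_eq (P : ProjectiveResolution X) {f f' : P.complex.X 1 ⟶ Y}
    (hf : P.complex.d 2 1 ≫ f = 0) (hf' : P.complex.d 2 1 ≫ f' = 0)
    (h : (P.extMk f 2 rfl hf : Abelian.Ext.{u} X Y 1) = P.extMk f' 2 rfl hf') :
    ∃ g : P.complex.X 0 ⟶ Y, P.complex.d 1 0 ≫ g = f - f' := by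
  rw [← sub_eq_zero, P.sub_extMk f f' 2 rfl hf hf'] at h
  exact (P.extMk_eq_zero_iff _ _ _ _ 0 rfl).1 h

/-- The cap product with a class of degree one does not depend on the choice of a representing
cocycle and of its lift. -/
theorem derivedShift_eq_of_extMk_eq (P : ProjectiveResolution X) (Q : ProjectiveResolution Y)
    {f f' : P.complex.X 1 ⟶ Y}
    (hf : P.complex.d 2 1 ≫ f = 0) (hf' : P.complex.d 2 1 ≫ f' = 0)
    (h : (P.extMk f 2 rfl hf : Abelian.Ext.{u} X Y 1) = P.extMk f' 2 rfl hf')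
    (F F' : shiftDown P.complex 1 ⟶ Q.complex)
    (hF : F.f 0 ≫ augmentation Q = f) (hF' : F'.f 0 ≫ augmentation Q = f') (n : ℕ) :
    derivedShift T P Q F n = derivedShift T P Q F' n := by
  obtain ⟨g, hg⟩ := exists_coboundary_of_extMk_eq P hf hf' h
  rw [derivedShift, shiftedHomologyMap_eq_of_coboundary T
    (isLeftResolution_of_projectiveResolution Q) P.projective F F' g (by rw [hF, hF']; exact hg.symm)]
  rfl

end

end

/-! ### Independence of choices and naturality of the cap product over an algebra -/

section

open Abelian

variable (k : Type u) [Field k] {A : Type u} [Ring A] [Algebra k A]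
  {X Y : ModuleCat.{u} Aᵐᵒᵖ}

/-- The cap product with a class of degree one, computed by any representing cocycle on the
chosen resolution and any lift of it. -/
theorem cap_eq_derivedShift {e : Ext.{u} X Y 1} (n : ℕ) (N : ModuleCat.{u} A)
    {f : (projectiveResolution X).complex.X 1 ⟶ Y}
    (hf : (projectiveResolution X).complex.d 2 1 ≫ f = 0)
    (he : (projectiveResolution X).extMk f 2 rfl hf = e)
    (F : shiftDown (projectiveResolution X).complex 1 ⟶ (projectiveResolution Y).complex)
    (hF : F.f 0 ≫ augmentation (projectiveResolution Y) = f) :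
    cap k e n N = derivedShift (tensorRight k A N) _ _ F n := by
  let P := projectiveResolution X
  let Q := projectiveResolution Y
  let hc := P.extMk_surjective e 2 rfl
  let hl := exists_liftCocycle P Q 1 hc.choose hc.choose_spec.choose
  exact derivedShift_eq_of_extMk_eq _ P Q hc.choose_spec.choose hf
    (hc.choose_spec.choose_spec.trans he.symm) hl.choose F
    -- For p = 1 the identification of degree 0 + 1 with degree 1 is the identity by definition.
    (hl.choose_spec.trans (Category.id_comp _)) hF n

/-- A single cocycle and a single lift serve for all n and N. Naturality of the cap product thereby
reduces to naturality of `derivedShift`. -/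
theorem exists_cap_eq (e : Ext.{u} X Y 1) :
    ∃ (f : (projectiveResolution X).complex.X 1 ⟶ Y)
      (hf : (projectiveResolution X).complex.d 2 1 ≫ f = 0)
      (F : shiftDown (projectiveResolution X).complex 1 ⟶ (projectiveResolution Y).complex),
      (projectiveResolution X).extMk f 2 rfl hf = e ∧
      F.f 0 ≫ augmentation (projectiveResolution Y) = f ∧
      ∀ n N, cap k e n N = derivedShift (tensorRight k A N) _ _ F n := by
  obtain ⟨f, hf, he⟩ := (projectiveResolution X).extMk_surjective e 2 rfl
  obtain ⟨F, hF⟩ := exists_liftCocycle (projectiveResolution X) (projectiveResolution Y) 1 f hf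
  replace hF := hF.trans (Category.id_comp f)
  exact ⟨f, hf, F, he, hF, fun n N => cap_eq_derivedShift k n N hf he F hF⟩

/-- The cap product is natural in the second argument of `Ext`. -/
theorem cap_comp_mk₀ (e : Ext.{u} X Y 1) {Y' : ModuleCat.{u} Aᵐᵒᵖ} (a : Y ⟶ Y') (n : ℕ)
    (N : ModuleCat.{u} A) :
    cap k (e.comp (Ext.mk₀ a) (add_zero 1)) n N =
      cap k e n N ≫ ((Tor k A n).map a).app N := by
  obtain ⟨f, hf, F, he, hF, h⟩ := exists_cap_eq k e
  have hψ := ProjectiveResolution.lift_commutes_zero a (projectiveResolution Y)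
    (projectiveResolution Y')
  set ψ := ProjectiveResolution.lift a (projectiveResolution Y) (projectiveResolution Y')
  rw [h, cap_eq_derivedShift k n N (f := f ≫ a) (by rw [← Category.assoc, hf, zero_comp])
    (by rw [← he, ProjectiveResolution.extMk_comp_mk₀]) (F ≫ ψ)
    (by rw [← hF, HomologicalComplex.comp_f, Category.assoc, Category.assoc]; exact congrArg _ hψ)]
  exact (derivedShift_comp _ _ _ F n _ a ψ hψ).symm

/-- The cap product is natural in the first argument of `Ext`. -/
theorem cap_mk₀_comp (e : Ext.{u} X Y 1) {X' : ModuleCat.{u} Aᵐᵒᵖ} (b : X' ⟶ X) (n : ℕ)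
    (N : ModuleCat.{u} A) :
    cap k ((Ext.mk₀ b).comp e (zero_add 1)) n N =
      ((Tor k A (n + 1)).map b).app N ≫ cap k e n N := by
  obtain ⟨f, hf, F, he, hF, h⟩ := exists_cap_eq k e
  have hφ := ProjectiveResolution.lift_commutes_zero b (projectiveResolution X')
    (projectiveResolution X)
  set φ := ProjectiveResolution.lift b (projectiveResolution X') (projectiveResolution X)
  rw [h, cap_eq_derivedShift k n N (f := φ.f 1 ≫ f)
    (by rw [← HomologicalComplex.Hom.comm_assoc, hf, comp_zero])
    (by rw [← he, ProjectiveResolution.mk₀_comp_extMk f 2 rfl hf (R' := projectiveResolution X')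
          ⟨φ, hφ.trans (by simp)⟩])
    (shiftDownMap φ 1 ≫ F)
    (by rw [← hF, HomologicalComplex.comp_f, Category.assoc])]
  exact (comp_derivedShift _ _ _ F n _ b φ hφ).symm

/-- The cap product is natural in the left module. -/
theorem cap_natural (e : Ext.{u} X Y 1) (n : ℕ) {N N' : ModuleCat.{u} A} (h : N ⟶ N') :
    cap k e n N ≫ ((Tor k A n).obj Y).map h = ((Tor k A (n + 1)).obj X).map h ≫ cap k e n N' := by
  obtain ⟨f, hf, F, he, hF, hc⟩ := exists_cap_eq k e
  rw [hc, hc]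
  exact derivedShift_natural (tensorRightMap k A h) _ _ F n

end

end NCTor

/-! ### The long exact sequence of an extension -/

namespace NCTor

section

variable {C : Type*} [Category* C] [Abelian C]

/-- Snake lemma: σ lifts a cycle of degree n + 1 to the middle complex, and the term through τ in
its boundary vanishes because the element is a cycle, leaving c times G. Neither σ nor τ has to
belong to a chain map; c absorbs the sign. -/
theorem δ_eq_smul_homologyShift {S : ShortComplex (ChainComplex C ℕ)} (hS : S.ShortExact)
    (G : shiftDown S.X₃ 1 ⟶ S.X₁) (n : ℕ) (c : ℤ) (σ : S.X₃.X (n + 1) ⟶ S.X₂.X (n + 1))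
    (hσ : σ ≫ S.g.f (n + 1) = 𝟙 _)
    (τ : S.X₃.X n ⟶ S.X₂.X n)
    (hd : σ ≫ S.X₂.d (n + 1) n = S.X₃.d (n + 1) n ≫ τ + c • (G.f n ≫ S.f.f n)) :
    hS.δ (n + 1) n rfl = c • homologyShift G n := by
  rw [← cancel_epi (S.X₃.homologyπ (n + 1))]
  have hx : (c • (S.X₃.iCycles (n + 1) ≫ G.f n)) ≫ S.f.f n =
      (S.X₃.iCycles (n + 1) ≫ σ) ≫ S.X₂.d (n + 1) n := by
    rw [Category.assoc, hd, Preadditive.zsmul_comp, Preadditive.comp_add,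
      HomologicalComplex.iCycles_d_assoc, zero_comp, zero_add, Preadditive.comp_zsmul,
      Category.assoc]
  have h := hS.δ_eq (n + 1) n rfl (S.X₃.iCycles (n + 1)) (S.X₃.iCycles_d _ _)
    (S.X₃.iCycles (n + 1) ≫ σ) (by rw [Category.assoc, hσ, Category.comp_id])
    (c • (S.X₃.iCycles (n + 1) ≫ G.f n)) hx _ rfl
  -- The connecting map was evaluated on the universal cycle, so the induced map to cycles is the
  -- identity.
  have e : S.X₃.liftCycles (S.X₃.iCycles (n + 1)) n
      ((ComplexShape.down ℕ).next_eq' rfl) (S.X₃.iCycles_d _ _) = 𝟙 _ := by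
    rw [← cancel_mono (S.X₃.iCycles (n + 1)), HomologicalComplex.liftCycles_i, Category.id_comp]
  rw [e, Category.id_comp] at h
  refine h.trans ?_
  rw [Preadditive.comp_zsmul, homologyπ_comp_homologyShift G n _ rfl]
  refine Eq.trans ?_ (Preadditive.zsmul_comp ..)
  congr 1
  rw [← cancel_mono (S.X₁.iCycles n)]
  simp

/-- In degree 0 the homology is the cokernel of the differential, and cokernels preserve
epimorphisms. -/
instance epi_homologyMap_zero {K L : ChainComplex C ℕ} (φ : K ⟶ L) [Epi φ] :
    Epi (HomologicalComplex.homologyMap φ 0) := by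
  have h := K.isoHomologyι₀_inv_naturality φ
  rw [Iso.inv_comp_eq] at h
  rw [h]
  infer_instance

/-! ### The direct sum of two complexes twisted by a chain map of degree -1 -/

section

variable {K L : ChainComplex C ℕ} (G : shiftDown K 1 ⟶ L)

/-- The differential of the complex `twist G`. -/
noncomputable def twistD (n : ℕ) : L.X (n + 1) ⊞ K.X (n + 1) ⟶ L.X n ⊞ K.X n :=
  biprod.desc (L.d (n + 1) n ≫ biprod.inl)
    (K.d (n + 1) n ≫ biprod.inr + (-1 : ℤ) ^ (n + 1) • (G.f n ≫ biprod.inl))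

/-- The complex `L ⊕ K` with the differential twisted by a chain map `K_{• + 1} → L`. -/
noncomputable def twist : ChainComplex C ℕ :=
  ChainComplex.of (fun n => L.X n ⊞ K.X n) (twistD G) (fun n => by
    -- G commutes with the differentials without a sign, so the alternating factor is what cancels
    -- the two cross terms of the squared differential.
    have h : G.f (n + 1) ≫ L.d (n + 1) n = K.d (n + 2) (n + 1) ≫ G.f n := G.comm _ _
    ext <;> simp [twistD, reassoc_of% h, pow_succ])

theorem twist_d (n : ℕ) : (twist G).d (n + 1) n = twistD G n :=
  ChainComplex.of_d (fun n => L.X n ⊞ K.X n) (twistD G) n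

/-- The inclusion `L → twist G`. -/
noncomputable def twistInl : L ⟶ twist G where
  f n := (biprod.inl : L.X n ⟶ L.X n ⊞ K.X n)
  comm' i j hij := by
    obtain rfl : j + 1 = i := hij
    rw [twist_d]
    exact biprod.inl_desc _ _

/-- The projection `twist G → K`. -/
noncomputable def twistSnd : twist G ⟶ K where
  f n := (biprod.snd : L.X n ⊞ K.X n ⟶ K.X n)
  comm' i j hij := by
    obtain rfl : j + 1 = i := hij
    rw [twist_d]
    change biprod.snd ≫ _ = twistD G j ≫ biprod.snd
    ext <;> simp [twistD]

/-- The sequence `L → twist G → K`. -/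
noncomputable def twistSeq : ShortComplex (ChainComplex C ℕ) where
  X₁ := L
  X₂ := twist G
  X₃ := K
  f := twistInl G
  g := twistSnd G
  zero := by
    ext n
    exact biprod.inl_snd

/-- The sequence `L → twist G → K` is split in each degree. -/
noncomputable def twistSeqSplitting (n : ℕ) :
    ((twistSeq G).map (HomologicalComplex.eval C _ n)).Splitting where
  r := (biprod.fst : L.X n ⊞ K.X n ⟶ L.X n)
  s := (biprod.inr : K.X n ⟶ L.X n ⊞ K.X n)
  f_r := biprod.inl_fst
  s_g := biprod.inr_snd
  id := biprod.total

/-- No exactness of T is needed, since the sequence splits in each degree. -/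
theorem twistSeq_map_shortExact {D : Type*} [Category* D] [Abelian D] (T : C ⥤ D) [T.Additive] :
    ((twistSeq G).map (T.mapHomologicalComplex _)).ShortExact :=
  HomologicalComplex.shortExact_of_degreewise_shortExact _
    (fun n => ((twistSeqSplitting G n).map T).shortExact)

theorem twistSeq_shortExact : (twistSeq G).ShortExact :=
  HomologicalComplex.shortExact_of_degreewise_shortExact _
    (fun n => (twistSeqSplitting G n).shortExact)

/-- The degreewise section `biprod.inr` fails to be a chain map exactly by the twisting term, and
this failure is the connecting map. -/
theorem twistSeq_map_δ {D : Type*} [Category* D] [Abelian D] (T : C ⥤ D) [T.Additive] (n : ℕ) :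
    (twistSeq_map_shortExact G T).δ (n + 1) n rfl =
      (-1 : ℤ) ^ (n + 1) • shiftedHomologyMap T G n := by
  refine δ_eq_smul_homologyShift (twistSeq_map_shortExact G T) (mapShift T G) n _
    (T.map (biprod.inr : K.X (n + 1) ⟶ L.X (n + 1) ⊞ K.X (n + 1)))
    ?_ (T.map (biprod.inr : K.X n ⟶ L.X n ⊞ K.X n)) ?_
  · exact (T.map_comp _ _).symm.trans ((congrArg T.map biprod.inr_snd).trans (T.map_id _))
  · refine (congrArg (T.map (biprod.inr : K.X (n + 1) ⟶ L.X (n + 1) ⊞ K.X (n + 1)) ≫ T.map ·)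
      (twist_d G n)).trans ?_
    refine ((T.map_comp _ _).symm.trans (congrArg T.map (biprod.inr_desc _ _))).trans ?_
    have e : T.map (K.d (n + 1) n ≫ (biprod.inr : K.X n ⟶ L.X n ⊞ K.X n) +
        (-1 : ℤ) ^ (n + 1) • (G.f n ≫ biprod.inl)) = T.map (K.d (n + 1) n) ≫ T.map biprod.inr +
        (-1 : ℤ) ^ (n + 1) • (T.map (G.f n) ≫ T.map biprod.inl) := by
      rw [T.map_add, T.map_zsmul, T.map_comp, T.map_comp]
    exact e

end

/-! ### Resolution of the middle term of an extension, and the resulting long exact sequence -/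

section

variable {S : ShortComplex C} (hS : S.ShortExact) (P : ProjectiveResolution S.X₃)
  (Q : ProjectiveResolution S.X₁) (F : shiftDown P.complex 1 ⟶ Q.complex)
  (g₀ : P.complex.X 0 ⟶ S.X₂) (hg : g₀ ≫ S.g = augmentation P)
  (hF : F.f 0 ≫ augmentation Q ≫ S.f = P.complex.d (0 + 1) 0 ≫ g₀)

include hS hg in
theorem epi_twist_augmentation : Epi (biprod.desc (augmentation Q ≫ S.f) g₀) := by
  have := hS.epi_g
  rw [Preadditive.epi_iff_cancel_zero]
  intro W h hh
  have h1 : (augmentation Q) ≫ S.f ≫ h = 0 := by simpa using biprod.inl ≫= hh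
  have h2 : g₀ ≫ h = 0 := by simpa using biprod.inr ≫= hh
  have h3 : S.f ≫ h = 0 := (cancel_epi (augmentation Q)).1 (by rw [h1, comp_zero])
  obtain ⟨h', rfl⟩ : ∃ h', S.g ≫ h' = h := ⟨hS.exact.desc h h3, hS.exact.g_desc h h3⟩
  have h4 : h' = 0 := (cancel_epi (augmentation P)).1 (by
    rw [comp_zero, ← hg, Category.assoc, h2])
  rw [h4, comp_zero]

-- The sign in degree 1 is -1, so `hF` is exactly the cancellation required on the summand from P.
include hF in
theorem twistD_comp_augmentation : twistD F 0 ≫ biprod.desc (augmentation Q ≫ S.f) g₀ = 0 := by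
  have h : Q.complex.d 1 0 ≫ augmentation Q = 0 := Q.complex_d_comp_π_f_zero
  ext
  · simp [twistD, reassoc_of% h]
  · simp [twistD, hF]

-- Chase with generalized elements. If (q, p) augments to 0, projecting to `S.X₃` shows that p is
-- the boundary of some p₁; then q + F₀ p₁ augments to 0 and is the boundary of some q₁. The pair
-- (q₁, p₁) bounds (q, p), again because the sign in degree 1 is -1.
include hS hg in
theorem exact_twist_augmentation :
    (ShortComplex.mk _ _ (twistD_comp_augmentation P Q F g₀ hF)).Exact := by
  have := hS.mono_f
  rw [ShortComplex.exact_iff_exact_up_to_refinements]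
  intro W x hx
  obtain ⟨q, p, rfl⟩ : ∃ q p, x = q ≫ biprod.inl + p ≫ biprod.inr :=
    ⟨x ≫ biprod.fst, x ≫ biprod.snd, by ext <;> simp⟩
  replace hx : q ≫ augmentation Q ≫ S.f + p ≫ g₀ = 0 := by simpa using hx
  have hp : p ≫ augmentation P = 0 := by
    simpa [hg] using hx =≫ S.g
  obtain ⟨W₁, π₁, _, p₁, hp₁⟩ := P.exact₀.exact_up_to_refinements p hp
  dsimp at p₁ hp₁
  have hq : (π₁ ≫ q + p₁ ≫ F.f 0) ≫ augmentation Q = 0 := by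
    rw [← cancel_mono S.f, zero_comp, Category.assoc, Preadditive.add_comp, Category.assoc,
      Category.assoc, hF]
    erw [← reassoc_of% hp₁]
    rw [← Preadditive.comp_add, hx, comp_zero]
  obtain ⟨W₂, π₂, _, q₁, hq₁⟩ := Q.exact₀.exact_up_to_refinements _ hq
  dsimp at q₁ hq₁
  refine ⟨W₂, π₂ ≫ π₁, inferInstance, q₁ ≫ biprod.inl + π₂ ≫ p₁ ≫ biprod.inr, ?_⟩
  have hq₂ : π₂ ≫ π₁ ≫ q = q₁ ≫ Q.complex.d 1 0 - π₂ ≫ p₁ ≫ F.f 0 := by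
    rw [← hq₁]; simp
  dsimp
  ext <;> simp [twistD, hq₂, hp₁, sub_eq_add_neg]

include hS hg hF in
theorem twist_isLeftResolution : IsLeftResolution (twist F)
    (biprod.desc (augmentation Q ≫ S.f) g₀ : Q.complex.X 0 ⊞ P.complex.X 0 ⟶ S.X₂) where
  d_comp := (congrArg (· ≫ biprod.desc (augmentation Q ≫ S.f) g₀) (twist_d F 0)).trans
    (twistD_comp_augmentation P Q F g₀ hF)
  epi := epi_twist_augmentation hS P Q g₀ hg
  exact₀ := by
    simp only [twist_d]
    exact exact_twist_augmentation hS P Q F g₀ hg hF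
  exact_succ n := by
    -- In positive degrees both outer complexes are exact, hence so is the middle one.
    have := (twistSeq_shortExact F).exactAt_X₂ (n + 1)
      (Q.complex_exactAt_succ n) (P.complex_exactAt_succ n)
    exact ((HomologicalComplex.exactAt_iff' _ (n + 2) (n + 1) n)
      (by simp only [ChainComplex.prev]; rfl) (by simp)).1 this

/-- The projective resolution of the middle term of an extension obtained from resolutions of the
outer terms. -/
noncomputable def twistResolution : ProjectiveResolution S.X₂ :=
  (twist_isLeftResolution hS P Q F g₀ hg hF).toProjectiveResolution
    (fun n => inferInstanceAs (Projective (Q.complex.X n ⊞ P.complex.X n)))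

theorem twistResolution_augmentation :
    augmentation (twistResolution hS P Q F g₀ hg hF) = biprod.desc (augmentation Q ≫ S.f) g₀ :=
  IsLeftResolution.toProjectiveResolution_augmentation _ _

theorem twistSnd_augmentation :
    (twistSnd F).f 0 ≫ augmentation P =
      augmentation (twistResolution hS P Q F g₀ hg hF) ≫ S.g := by
  rw [twistResolution_augmentation]
  change biprod.snd ≫ augmentation P = biprod.desc (augmentation Q ≫ S.f) g₀ ≫ S.g
  ext <;> simp [hg]

theorem twistInl_augmentation :
    (twistInl F).f 0 ≫ augmentation (twistResolution hS P Q F g₀ hg hF) =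
      augmentation Q ≫ S.f := by
  rw [twistResolution_augmentation]
  exact biprod.inl_desc _ _

variable [HasProjectiveResolutions C] {k : Type u} [Ring k] (T : C ⥤ ModuleCat.{u} k) [T.Additive]

-- Exactness of the long sequence at the derived functor of the quotient `S.X₃`, with `derivedShift`
-- as connecting map; its sign is invertible and affects neither kernel nor image.
include hS hg hF in
theorem exists_of_derivedShift_eq_zero (n : ℕ) (x : (T.leftDerived (n + 1)).obj S.X₃)
    (hx : derivedShift T P Q F n x = 0) : ∃ y, (T.leftDerived (n + 1)).map S.g y = x := by
  have hex := (ShortComplex.moduleCat_exact_iff _).1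
    ((twistSeq_map_shortExact F T).homology_exact₃ (n + 1) n rfl)
  have h0 : shiftedHomologyMap T F n ((derivedIso T P (n + 1)).hom x) = 0 := by
    have := congrArg (derivedIso T Q n).hom hx
    simpa [derivedShift] using this
  obtain ⟨y, hy⟩ := hex ((derivedIso T P (n + 1)).hom x) (by
    refine (congrArg (fun φ => φ.hom ((derivedIso T P (n + 1)).hom x))
      (twistSeq_map_δ F T n)).trans ?_
    change (-1 : ℤ) ^ (n + 1) • shiftedHomologyMap T F n ((derivedIso T P (n + 1)).hom x) = 0
    rw [h0, smul_zero])
  refine ⟨(derivedIso T (twistResolution hS P Q F g₀ hg hF) (n + 1)).inv y, ?_⟩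
  have e := congrArg (fun φ => φ.hom y) (derivedIso_inv_naturality T
    (twistResolution hS P Q F g₀ hg hF) P S.g (twistSnd F)
    (twistSnd_augmentation hS P Q F g₀ hg hF) (n + 1))
  refine e.trans ?_
  refine (congrArg (derivedIso T P (n + 1)).inv hy).trans ?_
  simp

-- Exactness of the same sequence at the derived functor of the subobject `S.X₁`.
include hS hg hF in
theorem exists_derivedShift_eq (n : ℕ) (x : (T.leftDerived n).obj S.X₁)
    (hx : (T.leftDerived n).map S.f x = 0) : ∃ y, derivedShift T P Q F n y = x := by
  have hex := (ShortComplex.moduleCat_exact_iff _).1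
    ((twistSeq_map_shortExact F T).homology_exact₁ (n + 1) n rfl)
  obtain ⟨y, h⟩ : ∃ y : ((T.mapHomologicalComplex _).obj P.complex).homology (n + 1),
      (-1 : ℤ) ^ (n + 1) • shiftedHomologyMap T F n y = (derivedIso T Q n).hom x := by
    obtain ⟨y, hy⟩ := hex ((derivedIso T Q n).hom x) (by
      have e := congrArg (fun φ => φ.hom x) (derivedIso_hom_naturality T Q
        (twistResolution hS P Q F g₀ hg hF) S.f (twistInl F)
        (twistInl_augmentation hS P Q F g₀ hg hF) n)
      refine e.symm.trans ?_
      refine (congrArg (derivedIso T (twistResolution hS P Q F g₀ hg hF) n).hom hx).trans ?_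
      exact map_zero (derivedIso T (twistResolution hS P Q F g₀ hg hF) n).hom.hom)
    exact ⟨y, (congrArg (fun φ => φ.hom y) (twistSeq_map_δ F T n)).symm.trans hy⟩
  refine ⟨(-1 : ℤ) ^ (n + 1) • (derivedIso T P (n + 1)).inv y, ?_⟩
  rw [map_zsmul]
  simp only [derivedShift, ModuleCat.comp_apply, Iso.inv_hom_id_apply]
  rw [← map_zsmul, h, Iso.hom_inv_id_apply]

-- The right end of the long sequence, where no connecting map follows.
include hS hg hF in
theorem leftDerived_zero_map_surjective :
    Function.Surjective ((T.leftDerived 0).map S.g) := by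
  have := (twistSeq_map_shortExact F T).epi_g
  have h1 : Function.Surjective
      (HomologicalComplex.homologyMap ((T.mapHomologicalComplex _).map (twistSnd F)) 0) :=
    (ModuleCat.epi_iff_surjective _).1
      (epi_homologyMap_zero ((twistSeq F).map (T.mapHomologicalComplex _)).g)
  intro x
  obtain ⟨y, hy⟩ := h1 ((derivedIso T P 0).hom x)
  refine ⟨(derivedIso T (twistResolution hS P Q F g₀ hg hF) 0).inv y, ?_⟩
  have e := congrArg (fun φ => φ.hom y) (derivedIso_inv_naturality T
    (twistResolution hS P Q F g₀ hg hF) P S.g (twistSnd F)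
    (twistSnd_augmentation hS P Q F g₀ hg hF) 0)
  refine e.trans ?_
  refine (congrArg (derivedIso T P 0).inv hy).trans ?_
  simp

end

end

end NCTor

/-! ### The comparison map of left derived functors along an exact functor -/

namespace NCTor

section

variable {C D E : Type*} [Category* C] [Abelian C] [Category* D] [Abelian D] [Category* E]
  [Abelian E] (R : C ⥤ D) [R.Additive] {T : D ⥤ E} [T.Additive] {T' : C ⥤ E} [T'.Additive]
  (β : R ⋙ T ⟶ T')

section

variable {R}

/-- The chain map `T (R K) → T' K` induced by a natural transformation `R ⋙ T → T'`. -/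
noncomputable def bridge (K : ChainComplex C ℕ) :
    (T.mapHomologicalComplex _).obj ((R.mapHomologicalComplex _).obj K) ⟶
      (T'.mapHomologicalComplex (ComplexShape.down ℕ)).obj K where
  f n := β.app (K.X n)
  comm' _ _ _ := (β.naturality (K.d _ _)).symm

theorem bridge_naturality {K L : ChainComplex C ℕ} (φ : K ⟶ L) :
    (T.mapHomologicalComplex _).map ((R.mapHomologicalComplex _).map φ) ≫ bridge β L =
      bridge β K ≫ (T'.mapHomologicalComplex _).map φ := by
  ext n
  exact β.naturality (φ.f n)

theorem isIso_mapHomologicalComplex_comp_bridge {I : C ⥤ D} [I.Additive] (α : I ⟶ R)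
    (h : ∀ M, IsIso (T.map (α.app M) ≫ β.app M)) (K : ChainComplex C ℕ) :
    IsIso ((T.mapHomologicalComplex _).map
      ((NatTrans.mapHomologicalComplex α (ComplexShape.down ℕ)).app K) ≫ bridge β K) := by
  have (n : ℕ) : IsIso (((T.mapHomologicalComplex _).map
      ((NatTrans.mapHomologicalComplex α (ComplexShape.down ℕ)).app K) ≫ bridge β K).f n) :=
    h (K.X n)
  exact HomologicalComplex.Hom.isIso_of_components _

end

/-- The image under `R` of the augmentation of a projective resolution. -/
noncomputable def mapAugmentation {M : C} (P : ProjectiveResolution M) :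
    ((R.mapHomologicalComplex _).obj P.complex).X 0 ⟶ R.obj M :=
  R.map (augmentation P)

theorem mapAugmentation_naturality {M M' : C} (P : ProjectiveResolution M)
    (P' : ProjectiveResolution M') (φ : M ⟶ M') (χ : P.complex ⟶ P'.complex)
    (hχ : χ.f 0 ≫ augmentation P' = augmentation P ≫ φ) :
    ((R.mapHomologicalComplex _).map χ).f 0 ≫ mapAugmentation R P' =
      mapAugmentation R P ≫ R.map φ :=
  (R.map_comp _ _).symm.trans ((congrArg R.map hχ).trans (R.map_comp _ _))

theorem mapAugmentation_natural {R : C ⥤ D} [R.Additive] {I : C ⥤ D} [I.Additive] (α : I ⟶ R)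
    {M : C} (P : ProjectiveResolution M) :
    ((NatTrans.mapHomologicalComplex α (ComplexShape.down ℕ)).app P.complex).f 0 ≫
      mapAugmentation R P = mapAugmentation I P ≫ α.app M :=
  (α.naturality (augmentation P)).symm

variable [R.PreservesHomology] [HasProjectiveResolutions C] [HasProjectiveResolutions D]

theorem exists_comparisonLift (M : C) :
    ∃ θ : (projectiveResolution (R.obj M)).complex ⟶
        (R.mapHomologicalComplex _).obj (projectiveResolution M).complex,
      θ.f 0 ≫ mapAugmentation R (projectiveResolution M) =
        augmentation (projectiveResolution (R.obj M)) :=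
  ((isLeftResolution_of_projectiveResolution (projectiveResolution M)).map R).exists_lift
    (projectiveResolution (R.obj M)).projective _
    (projectiveResolution (R.obj M)).complex_d_comp_π_f_zero

/-- A chain map from the chosen resolution of `R M` to the image under `R` of the chosen
resolution of `M`. -/
noncomputable def comparisonLift (M : C) : (projectiveResolution (R.obj M)).complex ⟶
    (R.mapHomologicalComplex _).obj (projectiveResolution M).complex :=
  (exists_comparisonLift R M).choose

theorem comparisonLift_augmentation (M : C) :
    (comparisonLift R M).f 0 ≫ mapAugmentation R (projectiveResolution M) =
      augmentation (projectiveResolution (R.obj M)) :=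
  (exists_comparisonLift R M).choose_spec

variable {R}

/-- The comparison map `L_n T (R M) → L_n T' (M)` induced by a natural transformation
`R ⋙ T → T'`, for an exact functor `R`. -/
noncomputable def comparison (n : ℕ) (M : C) :
    (T.leftDerived n).obj (R.obj M) ⟶ (T'.leftDerived n).obj M :=
  (derivedIso T (projectiveResolution (R.obj M)) n).hom ≫
    HomologicalComplex.homologyMap ((T.mapHomologicalComplex _).map (comparisonLift R M) ≫
      bridge β (projectiveResolution M).complex) n ≫
    (derivedIso T' (projectiveResolution M) n).inv

/-- Makes every choice of lift in the comparison map harmless: two lifts over the same map are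
already homotopic before T is applied. -/
theorem homologyMap_map_comp_bridge_eq {K : ChainComplex D ℕ} (hK : ∀ n, Projective (K.X n))
    {M : C} (P : ProjectiveResolution M)
    (F G : K ⟶ (R.mapHomologicalComplex _).obj P.complex)
    (hFG : F.f 0 ≫ mapAugmentation R P = G.f 0 ≫ mapAugmentation R P) (n : ℕ) :
    HomologicalComplex.homologyMap
        ((T.mapHomologicalComplex _).map F ≫ bridge β P.complex) n =
      HomologicalComplex.homologyMap
        ((T.mapHomologicalComplex _).map G ≫ bridge β P.complex) n := by
  obtain ⟨H⟩ := ((isLeftResolution_of_projectiveResolution P).map R).homotopy hK F G hFG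
  rw [HomologicalComplex.homologyMap_comp, HomologicalComplex.homologyMap_comp,
    (T.mapHomotopy H).homologyMap_eq n]

theorem comparison_naturality (n : ℕ) {M M' : C} (φ : M ⟶ M') :
    (T.leftDerived n).map (R.map φ) ≫ comparison β n M' =
      comparison β n M ≫ (T'.leftDerived n).map φ := by
  have hψ := ProjectiveResolution.lift_commutes_zero (R.map φ)
    (projectiveResolution (R.obj M)) (projectiveResolution (R.obj M'))
  have hφ := ProjectiveResolution.lift_commutes_zero φ
    (projectiveResolution M) (projectiveResolution M')
  set ψ := ProjectiveResolution.lift (R.map φ)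
    (projectiveResolution (R.obj M)) (projectiveResolution (R.obj M'))
  set χ := ProjectiveResolution.lift φ (projectiveResolution M) (projectiveResolution M')
  have key := homologyMap_map_comp_bridge_eq β
    (projectiveResolution (R.obj M)).projective (projectiveResolution M')
    (ψ ≫ comparisonLift R M') (comparisonLift R M ≫ (R.mapHomologicalComplex _).map χ) (by
      rw [HomologicalComplex.comp_f, HomologicalComplex.comp_f, Category.assoc, Category.assoc,
        comparisonLift_augmentation, mapAugmentation_naturality R _ _ φ χ hφ, ← Category.assoc,
        comparisonLift_augmentation]
      exact hψ) n
  simp only [comparison, Category.assoc,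
    derivedIso_hom_naturality_assoc T _ _ (R.map φ) ψ hψ n,
    derivedIso_inv_naturality T' _ _ φ χ hφ n,
    ← HomologicalComplex.homologyMap_comp_assoc]
  rw [← bridge_naturality, ← Functor.map_comp_assoc, ← Functor.map_comp_assoc, key]

theorem comparison_natural {T₁ T₂ : D ⥤ E} [T₁.Additive] [T₂.Additive] {T₁' T₂' : C ⥤ E}
    [T₁'.Additive] [T₂'.Additive] (β₁ : R ⋙ T₁ ⟶ T₁') (β₂ : R ⋙ T₂ ⟶ T₂') (γ : T₁ ⟶ T₂)
    (γ' : T₁' ⟶ T₂') (h : ∀ M, β₁.app M ≫ γ'.app M = γ.app (R.obj M) ≫ β₂.app M)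
    (n : ℕ) (M : C) :
    comparison β₁ n M ≫ (NatTrans.leftDerived γ' n).app M =
      (NatTrans.leftDerived γ n).app (R.obj M) ≫ comparison β₂ n M := by
  have e : ((T₁.mapHomologicalComplex _).map (comparisonLift R M) ≫
      bridge β₁ (projectiveResolution M).complex) ≫
        (NatTrans.mapHomologicalComplex γ' _).app (projectiveResolution M).complex =
      (NatTrans.mapHomologicalComplex γ _).app (projectiveResolution (R.obj M)).complex ≫
        (T₂.mapHomologicalComplex _).map (comparisonLift R M) ≫
          bridge β₂ (projectiveResolution M).complex := by
    rw [← NatTrans.naturality_assoc, Category.assoc]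
    congr 1
    ext i
    exact h _
  simp only [leftDerived_app_eq_derivedIso γ' (projectiveResolution M),
    leftDerived_app_eq_derivedIso γ (projectiveResolution (R.obj M)), comparison,
    Category.assoc, Iso.inv_hom_id_assoc, ← HomologicalComplex.homologyMap_comp_assoc, e]

/-- If `α : I → R` becomes invertible after composition with `T`, where `I` is exact and preserves
projective objects, then `L_n T (I M) → L_n T (R M)` followed by the comparison map is
invertible. -/
theorem isIso_leftDerived_map_comp_comparison {I : C ⥤ D} [I.Additive] [I.PreservesHomology]
    [I.PreservesProjectiveObjects] (α : I ⟶ R) (h : ∀ M, IsIso (T.map (α.app M) ≫ β.app M))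
    (n : ℕ) (M : C) : IsIso ((T.leftDerived n).map (α.app M) ≫ comparison β n M) := by
  let P := projectiveResolution M
  have hJ : IsLeftResolution ((I.mapHomologicalComplex _).obj P.complex)
    (mapAugmentation I P) := (isLeftResolution_of_projectiveResolution P).map I
  -- Since I is exact and preserves projectives, I(P) resolves I(M) and computes the derived
  -- functors there.
  let J : ProjectiveResolution (I.obj M) := hJ.toProjectiveResolution
    (fun i => Functor.PreservesProjectiveObjects.projective_obj (P.projective i))
  have hJa : augmentation J = mapAugmentation I P := hJ.toProjectiveResolution_augmentation _
  have hψ := ProjectiveResolution.lift_commutes_zero (α.app M) J (projectiveResolution (R.obj M))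
  set ψ := ProjectiveResolution.lift (α.app M) J (projectiveResolution (R.obj M))
  -- Both chain maps I(P) → R(P) lie over α at M, so the lift may be replaced by α itself; `h` then
  -- makes the composite with the bridge an isomorphism of complexes.
  have key := homologyMap_map_comp_bridge_eq β J.projective P (ψ ≫ comparisonLift R M)
    ((NatTrans.mapHomologicalComplex α _).app P.complex) (by
      rw [HomologicalComplex.comp_f, Category.assoc, comparisonLift_augmentation]
      exact (hψ.trans (congrArg (· ≫ α.app M) hJa)).trans (mapAugmentation_natural α P).symm) n
  simp only [comparison, derivedIso_hom_naturality_assoc T J _ (α.app M) ψ hψ n,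
    ← HomologicalComplex.homologyMap_comp_assoc]
  rw [← Functor.map_comp_assoc, key]
  have := isIso_mapHomologicalComplex_comp_bridge β α h P.complex
  have : IsIso (HomologicalComplex.homologyMap ((T.mapHomologicalComplex _).map
      ((NatTrans.mapHomologicalComplex α (ComplexShape.down ℕ)).app P.complex) ≫
        bridge β P.complex) n) :=
    inferInstanceAs (IsIso ((HomologicalComplex.homologyFunctor E _ n).map _))
  exact IsIso.comp_isIso' inferInstance (IsIso.comp_isIso' this inferInstance)

end

end NCTor

/-! ### The functor `lext` and its universal property -/

namespace LeibnizAlg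

open MulOpposite TensorProduct

open scoped ModuleCat

section

variable (k g : Type u) [Field k] [NonUnitalNonAssocRing g] [Module k g]

theorem rGen_mul (x y : g) :
    rGen k g (x * y) = rGen k g x * rGen k g y - rGen k g y * rGen k g x := by
  have h := RingQuot.mkAlgHom_rel k (ULRel.rr (k := k) x y)
  rw [map_sub, map_mul, map_mul] at h
  exact h

theorem lGen_mul (x y : g) :
    lGen k g (x * y) = lGen k g x * rGen k g y - rGen k g y * lGen k g x := by
  have h := RingQuot.mkAlgHom_rel k (ULRel.lr (k := k) x y)
  rw [map_sub, map_mul, map_mul] at h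
  exact h

theorem rGen_add_lGen_mul_lGen (x y : g) : (rGen k g x + lGen k g x) * lGen k g y = 0 := by
  have h := RingQuot.mkAlgHom_rel k (ULRel.rl (k := k) x y)
  rw [map_mul, map_add, map_zero] at h
  exact h

/-- The generators `r_x`, as a linear map. -/
noncomputable def rLin : g →ₗ[k] UL k g :=
  (mkUL k g).toLinearMap ∘ₗ TensorAlgebra.ι k ∘ₗ LinearMap.inr k g g

/-- The generators `l_x`, as a linear map. -/
noncomputable def lLin : g →ₗ[k] UL k g :=
  (mkUL k g).toLinearMap ∘ₗ TensorAlgebra.ι k ∘ₗ LinearMap.inl k g g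

variable [IsScalarTower k g g] [SMulCommClass k g g] [IsLeibniz g]

/-- The map `g_Lie → UL(g)` induced by `x ↦ r_x`. -/
noncomputable def rLie : LieQuot k g →ₗ[k] UL k g :=
  (squares k g).liftQ (rLin k g) (by
    rw [squares, Submodule.span_le]
    rintro _ ⟨x, rfl⟩
    change rGen k g (x * x) = 0
    rw [rGen_mul, sub_self])

theorem rLie_toLie (x : g) : rLie k g (toLie k g x) = rGen k g x := rfl

/-- The section `U(g_Lie) → UL(g)` of `d₀` and `d₁`, with `x̄ ↦ r_x`. -/
noncomputable def sU : U k g →ₐ[k] UL k g :=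
  liftU (rLie k g) (by
    intro x y
    obtain ⟨x, rfl⟩ := toLie_surjective k g x
    obtain ⟨y, rfl⟩ := toLie_surjective k g y
    rw [bracket_toLie, rLie_toLie, rLie_toLie, rLie_toLie, rGen_mul])

theorem sU_ιU (x : g) : sU k g (ιU k g x) = rGen k g x := liftU_ιU ..

theorem d₁_sU (a : U k g) : d₁ k g (sU k g a) = a := by
  induction a using U_induction with
  | hc c => simp
  | hι x => rw [sU_ιU, d₁_rGen]
  | hadd a b ha hb => rw [map_add, map_add, ha, hb]
  | hmul a b ha hb => rw [map_mul, map_mul, ha, hb]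

end

variable {k g : Type u} [Field k] [NonUnitalNonAssocRing g] [Module k g]
  [IsScalarTower k g g] [SMulCommClass k g g] [IsLeibniz g]

theorem lextMap_aux {M M' : RightLieMod k g} (f : M ⟶ M') (a : UL k g) :
    ∀ v : (M ⊗[k] g) × M,
      ((f.hom.restrictScalars k).rTensor g).prodMap (f.hom.restrictScalars k)
        ((lextRep M a).unop v) = (lextRep M' a).unop
          (((f.hom.restrictScalars k).rTensor g).prodMap (f.hom.restrictScalars k) v) := by
  induction a using UL_induction with
  | hc c => intro v; simp [AlgHom.commutes]
  | hl x =>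
    rintro ⟨t, n⟩
    rw [lextRep_lGen, lextRep_lGen]
    simp [lextL_apply, act_apply]
  | hr x =>
    rintro ⟨t, n⟩
    rw [lextRep_rGen, lextRep_rGen]
    have h := tensorDownMap_aux f (ιU k g x) t
    rw [diagRep_ιU, diagRep_ιU] at h
    simp only [unop_op] at h
    simp [lextR_apply, act_apply, h]
  | hadd a b ha hb => intro v; simp only [map_add, MulOpposite.unop_add, LinearMap.add_apply, ha, hb]
  | hmul a b ha hb =>
    intro v; simp only [map_mul, MulOpposite.unop_mul, Module.End.mul_apply, ha, hb]

/-- The functor `M ↦ lext(M)`. -/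
noncomputable def lextFunctor : RightLieMod k g ⥤ LeibMod k g where
  obj M := lext M
  map {M M'} f := homMk (X := lext M) (Y := lext M')
    (((f.hom.restrictScalars k).rTensor g).prodMap (f.hom.restrictScalars k) :
      (M ⊗[k] g) × M →ₗ[k] (M' ⊗[k] g) × M').toAddMonoidHom
    (fun a t => lextMap_aux f a t)
  map_id M := by
    ext v
    exact Prod.ext (LinearMap.rTensor_id_apply (R := k) g (M : Type u) v.1) rfl
  map_comp {M M' M''} f f' := by
    ext v
    exact Prod.ext (LinearMap.rTensor_comp_apply (R := k) g (f'.hom.restrictScalars k)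
      (f.hom.restrictScalars k) v.1) rfl

instance : (lextFunctor (k := k) (g := g)).Additive where
  map_add {M M'} f f' := by
    ext v
    refine Prod.ext ?_ rfl
    exact congrArg (fun φ => φ v.1) (LinearMap.rTensor_add (R := k) g
      (f.hom.restrictScalars k) (f'.hom.restrictScalars k))

/-- The projection `lext(M) → M^{d₁}` is natural. -/
noncomputable def lextSndNat : lextFunctor (k := k) (g := g) ⟶ resR₁ k g where
  app M := lextSnd M
  naturality _ _ _ := rfl

/-- The sequence `(M ⊗ g↓)^{d₀} → lext(M) → M^{d₁}` is natural. -/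
noncomputable def lextSeqMap {M M' : RightLieMod k g} (f : M ⟶ M') : lextSeq M ⟶ lextSeq M' where
  τ₁ := (resR₀ k g).map (tensorDown.map f)
  τ₂ := lextFunctor.map f
  τ₃ := (resR₁ k g).map f
  comm₁₂ := by
    ext t
    exact Prod.ext rfl (map_zero f.hom).symm
  comm₂₃ := rfl

/-- On underlying spaces the functor is (- ⊗ g) ⊕ id, and g is flat over the field k. -/
theorem lextFunctor_map_shortExact (S : ShortComplex (RightLieMod k g)) (hS : S.ShortExact) :
    (S.map lextFunctor).ShortExact where
  exact := by
    rw [ShortComplex.moduleCat_exact_iff]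
    rintro ⟨t, n⟩ h
    have hex : Function.Exact (S.f.hom.restrictScalars k) (S.g.hom.restrictScalars k) :=
      (ShortComplex.ShortExact.moduleCat_exact_iff_function_exact S).1 hS.exact
    have hsurj : Function.Surjective (S.g.hom.restrictScalars k) := hS.moduleCat_surjective_g
    obtain ⟨t', ht'⟩ := (rTensor_exact g hex hsurj t).1 (congrArg Prod.fst h)
    obtain ⟨n', hn'⟩ := (hex n).1 (congrArg Prod.snd h)
    exact ⟨(t', n'), Prod.ext ht' hn'⟩
  mono_f := (ModuleCat.mono_iff_injective _).2 (by
    have hinj : Function.Injective (S.f.hom.restrictScalars k) := hS.moduleCat_injective_f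
    have := Module.Flat.rTensor_preserves_injective_linearMap (M := g) _ hinj
    exact Function.Injective.prodMap this hinj)
  epi_g := (ModuleCat.epi_iff_surjective _).2 (by
    have hsurj : Function.Surjective (S.g.hom.restrictScalars k) := hS.moduleCat_surjective_g
    exact Function.Surjective.prodMap (LinearMap.rTensor_surjective g hsurj) hsurj)

instance : (lextFunctor (k := k) (g := g)).PreservesHomology := by
  have h := ((lextFunctor (k := k) (g := g)).exact_tfae.out 0 1).1 lextFunctor_map_shortExact
  exact Functor.preservesHomology_of_map_exact _ h

end LeibnizAlg

/-! ### lext(M) as extension of scalars along s -/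

namespace LeibnizAlg

open MulOpposite TensorProduct

open scoped ModuleCat

variable {k g : Type u} [Field k] [NonUnitalNonAssocRing g] [Module k g]
  [IsScalarTower k g g] [SMulCommClass k g g] [IsLeibniz g]

section

variable {A : Type u} [Ring A] [Algebra k A]

theorem op_algebraMap_smul (X : ModuleCat.{u} Aᵐᵒᵖ) (c : k) (x : X) :
    op (algebraMap k A c) • x = c • x := algebraMap_smul Aᵐᵒᵖ c x

end

variable (k g) in
/-- The restriction functor along `s : U(g_Lie) → UL(g)` on right modules. -/
noncomputable abbrev resS : LeibMod k g ⥤ RightLieMod k g :=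
  ModuleCat.restrictScalars (AlgHom.op (sU k g)).toRingHom

/-- The element `[t, n]` of `lext(M)`. -/
def lextMk {M : RightLieMod k g} (t : M ⊗[k] g) (n : M) : lext M := (t, n)

theorem lextMk_add {M : RightLieMod k g} (t t' : M ⊗[k] g) (n n' : M) :
    lextMk (t + t') (n + n') = lextMk t n + lextMk t' n' := rfl

theorem lextMk_eq_add {M : RightLieMod k g} (t : M ⊗[k] g) (n : M) :
    lextMk t n = lextMk t 0 + lextMk 0 n := by
  rw [← lextMk_add, add_zero, zero_add]

theorem r_smul_lextMk {M : RightLieMod k g} (y : g) (t : M ⊗[k] g) (n : M) :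
    op (rGen k g y) • lextMk t n = lextMk (diag M (toLie k g y) t) (op (ιU k g y) • n) := by
  change (lextRep M (rGen k g y)).unop (t, n) = _
  rw [lextRep_rGen]
  rfl

theorem l_smul_lextMk {M : RightLieMod k g} (z : g) (t : M ⊗[k] g) (n : M) :
    op (lGen k g z) • lextMk t n = lextMk (n ⊗ₜ z) (-(op (ιU k g z) • n)) := by
  change (lextRep M (lGen k g z)).unop (t, n) = _
  rw [lextRep_lGen]
  rfl

theorem sU_smul_lextMk {M : RightLieMod k g} (a : U k g) : ∀ n : M,
    op (sU k g a) • lextMk 0 n = lextMk 0 (op a • n) := by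
  induction a using U_induction with
  | hc c =>
    intro n
    rw [AlgHom.commutes, op_algebraMap_smul]
    change (lextRep M (algebraMap k _ c)).unop (0, n) = _
    rw [AlgHom.commutes]
    exact Prod.ext (smul_zero c) rfl
  | hι x =>
    intro n
    rw [sU_ιU, r_smul_lextMk, map_zero]
  | hadd a b ha hb =>
    intro n
    rw [map_add, MulOpposite.op_add, add_smul, ha, hb, MulOpposite.op_add, add_smul,
      ← lextMk_add, add_zero]
  | hmul a b ha hb =>
    intro n
    rw [map_mul, MulOpposite.op_mul, mul_smul, ha, hb, MulOpposite.op_mul, mul_smul]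

/-- In `lext(M)`, the element `[m ⊗ x, 0]` is `[0, m] (l_x + r_x)`. -/
theorem smul_lextMk_eq_tmul {M : RightLieMod k g} (m : M) (x : g) :
    op (lGen k g x + rGen k g x) • lextMk 0 m = lextMk (m ⊗ₜ x) 0 := by
  rw [MulOpposite.op_add, add_smul, l_smul_lextMk, r_smul_lextMk, map_zero, ← lextMk_add,
    add_zero, neg_add_cancel]

/-- The inclusion `M → lext(M)`, `m ↦ [0, m]`, is linear over `U(g_Lie)`. -/
noncomputable def lextInr (M : RightLieMod k g) : M ⟶ (resS k g).obj (lext M) :=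
  homMk (X := M) (Y := (resS k g).obj (lext M)) (LinearMap.inr k (M ⊗[k] g) M).toAddMonoidHom
    (fun a n => (sU_smul_lextMk a n).symm)

theorem lextMk_induction {M : RightLieMod k g} {p : lext M → Prop}
    (htmul : ∀ (m : M) (x : g), p (lextMk (m ⊗ₜ x) 0)) (hinr : ∀ m : M, p (lextMk 0 m))
    (hadd : ∀ v w, p v → p w → p (v + w)) (v : lext M) : p v := by
  obtain ⟨t, m⟩ := v
  have ht (t : M ⊗[k] g) : p (lextMk t 0) := by
    induction t using TensorProduct.induction_on with
    | zero => exact hinr 0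
    | tmul m x => exact htmul m x
    | add t t' ht ht' =>
      have := hadd _ _ ht ht'
      rwa [← lextMk_add, add_zero] at this
  have := hadd _ _ (ht t) (hinr m)
  rwa [← lextMk_eq_add] at this

/-- The elements [0, m] generate lext(M) over UL(g), by `smul_lextMk_eq_tmul`. -/
theorem lext_hom_ext {M : RightLieMod k g} {X : LeibMod k g} {f f' : lext M ⟶ X}
    (h : ∀ m : M, f.hom (lextMk 0 m) = f'.hom (lextMk 0 m)) : f = f' := by
  ext v
  induction v using lextMk_induction with
  | htmul m x => rw [← smul_lextMk_eq_tmul, map_smul, map_smul, h]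
  | hinr m => exact h m
  | hadd v w hv hw => rw [map_add, map_add, hv, hw]

section

variable {M : RightLieMod k g} {X : LeibMod k g} (u : M ⟶ (resS k g).obj X)

/-- The `k`-linear map underlying a morphism to a restricted module. -/
noncomputable def resSLin : M →ₗ[k] X where
  toFun m := u.hom m
  map_add' := map_add u.hom
  map_smul' c m := by
    have h : u.hom (op (algebraMap k (U k g) c) • m) =
        (op (sU k g (algebraMap k (U k g) c)) • (show X from u.hom m) : X) :=
      map_smul u.hom _ _
    rw [AlgHom.commutes, op_algebraMap_smul, op_algebraMap_smul] at h
    exact h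

theorem resSLin_ιU (m : M) (y : g) :
    resSLin u (op (ιU k g y) • m) = op (rGen k g y) • resSLin u m := by
  have h : u.hom (op (ιU k g y) • m) =
      (op (sU k g (ιU k g y)) • (show X from u.hom m) : X) := map_smul u.hom _ _
  rw [sU_ιU] at h
  exact h

/-- The right action of `l_x + r_x` on a right `UL(g)`-module. -/
noncomputable def actLR (X : LeibMod k g) : g →ₗ[k] X →ₗ[k] X :=
  (Algebra.lsmul k k (X : Type u)).toLinearMap ∘ₗ (opLinearEquiv k).toLinearMap ∘ₗ
    (lLin k g + rLin k g)

theorem actLR_apply (x : g) (y : X) :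
    actLR X x y = op (lGen k g x + rGen k g x) • y := rfl

/-- The `k`-linear map `lext(M) → X` extending a map `M → X`. -/
noncomputable def lextDescLin : (M ⊗[k] g) × M →ₗ[k] X :=
  (TensorProduct.lift ((actLR X).flip ∘ₗ resSLin u)).coprod (resSLin u)

theorem lextDescLin_inl_tmul (m : M) (x : g) :
    lextDescLin u (m ⊗ₜ x, 0) = op (lGen k g x + rGen k g x) • resSLin u m := by
  simp [lextDescLin, actLR_apply]

theorem lextDescLin_add (t t' : M ⊗[k] g) :
    lextDescLin u (t + t', 0) = lextDescLin u (t, 0) + lextDescLin u (t', 0) := by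
  rw [← map_add]; simp

theorem lextDescLin_eq_add (t : M ⊗[k] g) (n : M) :
    lextDescLin u (t, n) = lextDescLin u (t, 0) + resSLin u n := by simp [lextDescLin]

/-- Each relation of UL(g) has its role here. Compatibility with l_z holds on M ⊗ g because (r_x +
l_x) l_z = 0, and on M because u(n)(l_z + r_z) - u(n) r_z = u(n) l_z. Compatibility with r_y on M ⊗
g is the identity l_{xy} + r_{xy} = [l_x + r_x, r_y]. -/
theorem lextDescLin_aux (a : UL k g) : ∀ v : (M ⊗[k] g) × M,
    lextDescLin u ((lextRep M a).unop v) = op a • lextDescLin u v := by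
  induction a using UL_induction with
  | hc c =>
    intro v
    rw [AlgHom.commutes, op_algebraMap_smul]
    exact map_smul (lextDescLin u) c v
  | hl z =>
    rintro ⟨t, n⟩
    rw [lextRep_lGen, unop_op, lextL_apply, lextDescLin_eq_add, lextDescLin_inl_tmul,
      lextDescLin_eq_add u t n, smul_add]
    have h1 : resSLin u (-act M (toLie k g z) n) = -(op (rGen k g z) • resSLin u n) := by
      rw [map_neg]; exact congrArg Neg.neg (resSLin_ιU u n z)
    have h2 : op (lGen k g z) • lextDescLin u (t, 0) = 0 := by
      induction t using TensorProduct.induction_on with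
      | zero => exact (congrArg _ (map_zero (lextDescLin u))).trans (smul_zero _)
      | tmul m x =>
        rw [lextDescLin_inl_tmul, smul_smul, ← MulOpposite.op_mul, add_comm (lGen k g x),
          rGen_add_lGen_mul_lGen, MulOpposite.op_zero, zero_smul]
      | add t t' ht ht' => rw [lextDescLin_add, smul_add, ht, ht', add_zero]
    rw [h1, h2, MulOpposite.op_add, add_smul]
    abel
  | hr y =>
    rintro ⟨t, n⟩
    rw [lextRep_rGen, unop_op, lextR_apply]
    have h1 (n : M) : resSLin u (act M (toLie k g y) n) = op (rGen k g y) • resSLin u n :=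
      resSLin_ιU u n y
    rw [lextDescLin_eq_add, h1, lextDescLin_eq_add u t n, smul_add]
    congr 1
    induction t using TensorProduct.induction_on with
    | zero =>
      rw [map_zero]
      exact (map_zero (lextDescLin u)).trans
        ((congrArg _ (map_zero (lextDescLin u))).trans (smul_zero _)).symm
    | tmul m x =>
      rw [diag_tmul, gDown_toLie, lextDescLin_add, lextDescLin_inl_tmul, lextDescLin_inl_tmul,
        lextDescLin_inl_tmul, h1, smul_smul, smul_smul, ← add_smul, ← MulOpposite.op_mul,
        ← MulOpposite.op_mul, ← MulOpposite.op_add, lGen_mul, rGen_mul]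
      congr 2
      noncomm_ring
    | add t t' ht ht' =>
      rw [map_add, lextDescLin_add, lextDescLin_add, ht, ht', smul_add]
  | hadd a b ha hb =>
    intro v
    simp only [map_add, MulOpposite.unop_add, LinearMap.add_apply, ha, hb,
      MulOpposite.op_add, add_smul]
  | hmul a b ha hb =>
    intro v
    simp only [map_mul, MulOpposite.unop_mul, Module.End.mul_apply, ha, hb,
      MulOpposite.op_mul, mul_smul]

/-- A `U(g_Lie)`-linear map `M → X` extends to a `UL(g)`-linear map `lext(M) → X`. -/
noncomputable def lextDesc : lext M ⟶ X :=
  homMk (X := lext M) (Y := X) (lextDescLin u).toAddMonoidHom (fun a v => lextDescLin_aux u a v)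

theorem lextDesc_inr (m : M) :
    (lextDesc u).hom (lextMk 0 m) = (show X from u.hom m) := by
  change lextDescLin u (0, m) = _
  simp only [lextDescLin, LinearMap.coprod_apply, map_zero, zero_add]
  rfl

end

/-- The usual argument for a left adjoint of a functor preserving epimorphisms: lift M → X along the
restricted epimorphism, then extend the lift to lext(M). -/
instance : (lextFunctor (k := k) (g := g)).PreservesProjectiveObjects where
  projective_obj {M} hM := ⟨fun {E X} f e he => by
    have : Epi ((resS k g).map e) := (ModuleCat.epi_iff_surjective _).2
      ((ModuleCat.epi_iff_surjective e).1 he)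
    let u : M ⟶ (resS k g).obj E :=
      Projective.factorThru (lextInr M ≫ (resS k g).map f) ((resS k g).map e)
    have hu : u ≫ (resS k g).map e = lextInr M ≫ (resS k g).map f :=
      Projective.factorThru_comp _ _
    refine ⟨lextDesc u, lext_hom_ext fun m => ?_⟩
    have h := congrArg (fun φ => φ.hom m) hu
    exact (congrArg e.hom (lextDesc_inr u m)).trans h⟩

/-- The restriction functor `M ↦ M^{d₁}` is full. -/
theorem exists_resR₁_map_eq {M M' : RightLieMod k g}
    (v : (resR₁ k g).obj M ⟶ (resR₁ k g).obj M') : ∃ w : M ⟶ M', (resR₁ k g).map w = v := by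
  refine ⟨homMk (X := M) (Y := M') (AddMonoidHom.mk' (fun m => v.hom m) (map_add v.hom))
    (fun a m => ?_), rfl⟩
  -- Linearity over U(g_Lie) is linearity over UL(g) tested on elements s(a), which act as a because
  -- d₁ s = id.
  have h : v.hom ((op (sU k g a) : (UL k g)ᵐᵒᵖ) • (show (resR₁ k g).obj M from m)) =
      (op (sU k g a) : (UL k g)ᵐᵒᵖ) • v.hom m := map_smul v.hom _ _
  have e (M : RightLieMod k g) (m : M) :
      (op (sU k g a) : (UL k g)ᵐᵒᵖ) • (show (resR₁ k g).obj M from m) =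
        (show (resR₁ k g).obj M from op a • m) := by
    change op (d₁ k g (sU k g a)) • m = op a • m
    rw [d₁_sU]
  rw [e] at h
  exact h.trans (e M' _)

end LeibnizAlg

/-! ### Comparison of the tensor products over `UL(g)` and `U(g_Lie)` -/

namespace LeibnizAlg

open MulOpposite TensorProduct NCTor

open scoped ModuleCat

variable {k g : Type u} [Field k] [NonUnitalNonAssocRing g] [Module k g]
  [IsScalarTower k g g] [SMulCommClass k g g] [IsLeibniz g]

/-- The identity `M^{d₁} → M`, as a `k`-linear isomorphism. -/
noncomputable def resR₁Lin (M : RightLieMod k g) : (resR₁ k g).obj M ≃ₗ[k] M where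
  toFun m := m
  invFun m := m
  left_inv _ := rfl
  right_inv _ := rfl
  map_add' _ _ := rfl
  map_smul' c m := by
    have h := op_algebraMap_smul ((resR₁ k g).obj M) c m
    change (op (d₁ k g (algebraMap k (UL k g) c)) • (show M from m) : M) = _ at h
    rw [AlgHom.commutes, op_algebraMap_smul] at h
    exact h.symm

/-- The identity `^{d₁}N → N`, as a `k`-linear isomorphism. -/
noncomputable def resL₁Lin (N : LeftLieMod k g) : (resL₁ k g).obj N ≃ₗ[k] N where
  toFun n := n
  invFun n := n
  left_inv _ := rfl
  right_inv _ := rfl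
  map_add' _ _ := rfl
  map_smul' c n := by
    have h := algebraMap_smul (UL k g) c n
    change (d₁ k g (algebraMap k (UL k g) c) • (show N from n) : N) = _ at h
    rw [AlgHom.commutes, algebraMap_smul] at h
    exact h.symm

theorem resR₁Lin_smul (M : RightLieMod k g) (a : UL k g) (m : (resR₁ k g).obj M) :
    resR₁Lin M (op a • m) = op (d₁ k g a) • resR₁Lin M m := rfl

theorem resL₁Lin_smul (N : LeftLieMod k g) (a : UL k g) (n : (resL₁ k g).obj N) :
    resL₁Lin N (a • n) = d₁ k g a • resL₁Lin N n := rfl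

theorem smul_resL₁Lin_symm (N : LeftLieMod k g) (a : UL k g) (n : N) :
    a • (resL₁Lin N).symm n = (resL₁Lin N).symm (d₁ k g a • n) := rfl

/-- The canonical map `M^{d₁} ⊗_{UL(g)} ^{d₁}N → M ⊗_{U(g_Lie)} N`. -/
noncomputable def tensorRes (M : RightLieMod k g) (N : LeftLieMod k g) :
    (((resR₁ k g).obj M ⊗[k] (resL₁ k g).obj N) ⧸
        balanced k ((resR₁ k g).obj M) ((resL₁ k g).obj N)) →ₗ[k]
      ((M ⊗[k] N) ⧸ balanced k M N) :=
  (balanced k _ _).mapQ (balanced k M N)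
    (TensorProduct.map (resR₁Lin M).toLinearMap (resL₁Lin N).toLinearMap) (by
      rw [balanced, Submodule.span_le]
      rintro _ ⟨m, a, n, rfl⟩
      refine Submodule.subset_span ⟨resR₁Lin M m, d₁ k g a, resL₁Lin N n, ?_⟩
      simp only [map_sub, TensorProduct.map_tmul, LinearEquiv.coe_coe]
      rw [resR₁Lin_smul, resL₁Lin_smul])

/-- The canonical map `M^{d₁} ⊗_{UL(g)} ^{d₁}N → M ⊗_{U(g_Lie)} N` is natural in `M`. -/
noncomputable def tensorResNat (N : LeftLieMod k g) :
    resR₁ k g ⋙ tensorRight k (UL k g) ((resL₁ k g).obj N) ⟶ tensorRight k (U k g) N where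
  app M := ModuleCat.ofHom (tensorRes M N)
  naturality M M' f := by
    ext : 1
    refine Submodule.linearMap_qext _ (TensorProduct.ext' fun m n => ?_)
    rfl

theorem tensorResNat_naturality {N N' : LeftLieMod k g} (h : N ⟶ N') (M : RightLieMod k g) :
    (tensorResNat N).app M ≫ (tensorRightMap k (U k g) h).app M =
      (tensorRightMap k (UL k g) ((resL₁ k g).map h)).app ((resR₁ k g).obj M) ≫
        (tensorResNat N').app M := by
  refine ModuleCat.hom_ext (Submodule.linearMap_qext _ (TensorProduct.ext' fun m n => ?_))
  rfl

/-- The map `M ⊗_{U(g_Lie)} N → lext(M) ⊗_{UL(g)} ^{d₁}N`, `m ⊗ n ↦ [0, m] ⊗ n`. -/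
noncomputable def tensorLext (M : RightLieMod k g) (N : LeftLieMod k g) :
    ((M ⊗[k] N) ⧸ balanced k M N) →ₗ[k]
      ((lext M ⊗[k] (resL₁ k g).obj N) ⧸ balanced k (lext M) ((resL₁ k g).obj N)) :=
  (balanced k M N).mapQ (balanced k (lext M) ((resL₁ k g).obj N))
    (TensorProduct.map (resSLin (lextInr M)) (resL₁Lin N).symm.toLinearMap) (by
      rw [balanced, Submodule.span_le]
      rintro _ ⟨m, a, n, rfl⟩
      -- The scalar s(a) acts as a both on the elements [0, m] and, since d₁ s = id, on N.
      refine Submodule.subset_span ⟨lextMk 0 m, sU k g a, (resL₁Lin N).symm n, ?_⟩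
      rw [sU_smul_lextMk, smul_resL₁Lin_symm, d₁_sU, map_sub]
      rfl)

/-- [m ⊗ x, 0] = [0, m](l_x + r_x), and l_x + r_x acts on N through d₁(l_x + r_x) = 0. So the whole
subspace M ⊗ g of lext(M) disappears in the tensor product. -/
theorem mkQ_lextMk_tmul (M : RightLieMod k g) (N : LeftLieMod k g) (m : M) (x : g)
    (n : (resL₁ k g).obj N) :
    (balanced k (lext M) ((resL₁ k g).obj N)).mkQ (lextMk (m ⊗ₜ x) 0 ⊗ₜ[k] n) = 0 := by
  have h : lextMk (m ⊗ₜ x) 0 ⊗ₜ[k] n ∈ balanced k (lext M) ((resL₁ k g).obj N) := by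
    refine Submodule.subset_span ⟨lextMk 0 m, lGen k g x + rGen k g x, n, ?_⟩
    have e : (lGen k g x + rGen k g x) • n = 0 := by
      change (d₁ k g (lGen k g x + rGen k g x) • (show N from n) : N) = 0
      rw [map_add, d₁_lGen, d₁_rGen, neg_add_cancel, zero_smul]
    rw [smul_lextMk_eq_tmul, e, TensorProduct.tmul_zero, sub_zero]
  exact (Submodule.Quotient.mk_eq_zero _).2 h

/-- In `lext(M) ⊗_{UL(g)} ^{d₁}N`, the element `[t, m] ⊗ n` equals `[0, m] ⊗ n`. -/
theorem mkQ_lextMk_snd (M : RightLieMod k g) (N : LeftLieMod k g) (v : lext M)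
    (n : (resL₁ k g).obj N) :
    (balanced k (lext M) ((resL₁ k g).obj N)).mkQ
        (lextMk 0 (resR₁Lin M ((lextSnd M).hom v)) ⊗ₜ[k] n) =
      (balanced k (lext M) ((resL₁ k g).obj N)).mkQ (v ⊗ₜ[k] n) := by
  induction v using lextMk_induction with
  | htmul m x =>
    rw [mkQ_lextMk_tmul]
    have e : lextMk 0 (resR₁Lin M ((lextSnd M).hom (lextMk (m ⊗ₜ x) 0))) = 0 := rfl
    rw [e, TensorProduct.zero_tmul, map_zero]
  | hinr m => rfl
  | hadd v w hv hw =>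
    have e : lextMk 0 (resR₁Lin M ((lextSnd M).hom (v + w))) =
        lextMk 0 (resR₁Lin M ((lextSnd M).hom v)) +
          lextMk 0 (resR₁Lin M ((lextSnd M).hom w)) := by
      rw [← lextMk_add, add_zero, map_add, map_add]
    rw [e, TensorProduct.add_tmul, TensorProduct.add_tmul, map_add, map_add, hv, hw]

/-- This is lext(M) ⊗_{UL(g)} N ≅ M ⊗_{U(g_Lie)} N, with inverse `tensorLext`; it is the degree-free
input for the comparison of Tor. -/
theorem isIso_map_lextSnd_comp_tensorRes (N : LeftLieMod k g) (M : RightLieMod k g) :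
    IsIso ((tensorRight k (UL k g) ((resL₁ k g).obj N)).map (lextSndNat.app M) ≫
      (tensorResNat N).app M) := by
  refine ⟨ModuleCat.ofHom (tensorLext M N), ?_, ?_⟩
  · refine ModuleCat.hom_ext (Submodule.linearMap_qext _ (TensorProduct.ext' fun v n => ?_))
    exact mkQ_lextMk_snd M N v n
  · refine ModuleCat.hom_ext (Submodule.linearMap_qext _ (TensorProduct.ext' fun m n => ?_))
    rfl

end LeibnizAlg

/-! ### The connecting map of an extension -/

namespace NCTor

/-- A short exact sequence gives a cocycle on a resolution of the quotient, whose class is the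
class of the extension up to an endomorphism of the quotient. -/
theorem exists_cocycle_of_shortExact {C : Type*} [Category* C] [Abelian C] [HasExt C]
    {S : ShortComplex C} (hS : S.ShortExact) (P : ProjectiveResolution S.X₃) :
    ∃ (f : P.complex.X 1 ⟶ S.X₁) (hf : P.complex.d 2 1 ≫ f = 0) (g₀ : P.complex.X 0 ⟶ S.X₂)
      (v : S.X₃ ⟶ S.X₃), g₀ ≫ S.g = augmentation P ∧ f ≫ S.f = P.complex.d 1 0 ≫ g₀ ∧
        P.extMk f 2 rfl hf = (Abelian.Ext.mk₀ v).comp hS.extClass (zero_add 1) := by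
  have := hS.epi_g
  have := hS.mono_f
  let g₀ := Projective.factorThru (augmentation P) S.g
  have hg : g₀ ≫ S.g = augmentation P := Projective.factorThru_comp _ _
  have h₁ : (P.complex.d 1 0 ≫ g₀) ≫ S.g = 0 := by
    rw [Category.assoc, hg]
    exact P.complex_d_comp_π_f_zero
  let f := hS.exact.lift (P.complex.d 1 0 ≫ g₀) h₁
  have hfS : f ≫ S.f = P.complex.d 1 0 ≫ g₀ := hS.exact.lift_f _ _
  have hf : P.complex.d 2 1 ≫ f = 0 := by
    rw [← cancel_mono S.f, Category.assoc, hfS, HomologicalComplex.d_comp_d_assoc, zero_comp,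
      zero_comp]
  -- Pushed into `S.X₂`, the cocycle is the coboundary of `g₀`. The covariant Ext sequence then
  -- gives the endomorphism v; it is left unidentified, so no sign convention for `extClass` is
  -- needed.
  have h₂ : (P.extMk f 2 rfl hf).comp (Abelian.Ext.mk₀ S.f) (add_zero 1) = 0 := by
    rw [P.extMk_comp_mk₀, P.extMk_eq_zero_iff _ _ _ _ 0 rfl]
    exact ⟨g₀, hfS.symm⟩
  obtain ⟨x, hx⟩ := Abelian.Ext.covariant_sequence_exact₁ _ hS _ h₂ (zero_add 1)
  obtain ⟨v, rfl⟩ := (Abelian.Ext.mk₀_bijective _ _).2 x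
  exact ⟨f, hf, g₀, v, hg, hfS, hx.symm⟩

theorem leftDerived_map_zero {C D : Type*} [Category* C] [Abelian C] [HasProjectiveResolutions C]
    [Category* D] [Abelian D] (T : C ⥤ D) [T.Additive] (n : ℕ) (X Y : C) :
    (T.leftDerived n).map (0 : X ⟶ Y) = 0 := by
  rw [T.leftDerived_map_eq n 0 (P := projectiveResolution X) (Q := projectiveResolution Y) 0
    (by simp), Functor.map_zero, zero_comp, comp_zero]

theorem cap_zero (k : Type u) [Field k] {A : Type u} [Ring A] [Algebra k A]
    {X Y : ModuleCat.{u} Aᵐᵒᵖ} (n : ℕ) (N : ModuleCat.{u} A) :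
    cap k (0 : Abelian.Ext.{u} X Y 1) n N = 0 := by
  have h := cap_comp_mk₀ k (0 : Abelian.Ext.{u} X Y 1) (0 : Y ⟶ Y) n N
  rw [Abelian.Ext.zero_comp] at h
  rw [h]
  have e : ((Tor k A n).map (0 : Y ⟶ Y)).app N = 0 :=
    leftDerived_map_zero (tensorRight k A N) n Y Y
  rw [e, comp_zero]

end NCTor

/-! ### Splitting the long exact sequence of lext(M) -/

namespace LeibnizAlg

open MulOpposite TensorProduct NCTor

open scoped ModuleCat

/-- The image of s is the kernel of d, and c is invertible on it, so (c, d) is bijective. The target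
enters only through the identity p ≫ i + q ≫ j = 𝟙, which can be read off a biproduct of functors
after evaluation. -/
theorem isIso_of_biproduct {R : Type*} [Ring R] {X Y A B Z : ModuleCat.{u} R} (s : Y ⟶ X)
    (c : X ⟶ A) (d : X ⟶ B) (hsc : IsIso (s ≫ c)) (hsd : s ≫ d = 0)
    (hd : ∀ x, d x = 0 → ∃ y, s y = x) (hd' : Function.Surjective d)
    (L : X ⟶ Z) (p : Z ⟶ A) (q : Z ⟶ B) (i : A ⟶ Z) (j : B ⟶ Z)
    (hp : L ≫ p = c) (hq : L ≫ q = d) (hpq : p ≫ i + q ≫ j = 𝟙 Z) : IsIso L := by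
  have hpq' (z : Z) : i (p z) + j (q z) = z := congrArg (fun φ => φ.hom z) hpq
  have hp' (x : X) : p (L x) = c x := congrArg (fun φ => φ.hom x) hp
  have hq' (x : X) : q (L x) = d x := congrArg (fun φ => φ.hom x) hq
  have hsd' (y : Y) : d (s y) = 0 := congrArg (fun φ => φ.hom y) hsd
  obtain ⟨hinj, hsurj⟩ : Function.Bijective (fun y => c (s y)) :=
    (ConcreteCategory.isIso_iff_bijective (s ≫ c)).1 hsc
  refine (ConcreteCategory.isIso_iff_bijective L).2 ⟨?_, fun z => ?_⟩
  · rw [injective_iff_map_eq_zero]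
    intro x hx
    obtain ⟨y, rfl⟩ := hd x (by rw [← hq', hx, map_zero])
    have : y = 0 := hinj (by
      change c (s y) = c (s 0)
      rw [← hp', hx, map_zero, map_zero, map_zero])
    rw [this, map_zero]
  · obtain ⟨x, hx⟩ := hd' (q z)
    obtain ⟨y, hy⟩ := hsurj (p z - c x)
    refine ⟨x + s y, ?_⟩
    have h₁ : p (L (x + s y)) = p z := by
      rw [hp', map_add]
      exact (congrArg (c x + ·) hy).trans (add_sub_cancel _ _)
    have h₂ : q (L (x + s y)) = q z := by rw [hq', map_add, hsd', add_zero, hx]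
    rw [← hpq' (L (x + s y)), h₁, h₂, hpq']

variable {k g : Type u} [Field k] [NonUnitalNonAssocRing g] [Module k g]
  [IsScalarTower k g g] [SMulCommClass k g g] [IsLeibniz g]

instance : (resR₁ k g).PreservesHomology :=
  Functor.preservesHomology_of_map_exact _ fun S hS => by
    rw [ShortComplex.moduleCat_exact_iff] at hS ⊢
    exact hS

theorem lextClass_naturality {M M' : RightLieMod k g} (w : M ⟶ M') :
    (lextClass M).comp (Abelian.Ext.mk₀ ((resR₀ k g).map (tensorDown.map w))) (add_zero 1) =
      (Abelian.Ext.mk₀ ((resR₁ k g).map w)).comp (lextClass M') (zero_add 1) :=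
  ShortComplex.ShortExact.extClass_naturality (lextSeq_shortExact M) (lextSeq_shortExact M')
    (lextSeqMap w)

/-- The cap product with `[lext(M)]` is natural in `M`. -/
theorem cap_lextClass_naturality {M M' : RightLieMod k g} (w : M ⟶ M') (n : ℕ)
    (N : ModuleCat.{u} (UL k g)) :
    ((Tor k (UL k g) (n + 1)).map ((resR₁ k g).map w)).app N ≫ cap k (lextClass M') n N =
      cap k (lextClass M) n N ≫
        ((Tor k (UL k g) n).map ((resR₀ k g).map (tensorDown.map w))).app N := by
  rw [← cap_comp_mk₀, ← cap_mk₀_comp, lextClass_naturality]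

/-- The connecting maps of the sequence `lextSeq M` differ from the cap product with `[lext(M)]`
by the action of an endomorphism of `M`. -/
theorem exists_derivedShift_eq_cap (M : RightLieMod k g) :
    ∃ (F : shiftDown (projectiveResolution (lextSeq M).X₃).complex 1 ⟶
        (projectiveResolution (lextSeq M).X₁).complex)
      (g₀ : (projectiveResolution (lextSeq M).X₃).complex.X 0 ⟶ (lextSeq M).X₂)
      (w : M ⟶ M),
      g₀ ≫ (lextSeq M).g = augmentation _ ∧
      F.f 0 ≫ augmentation _ ≫ (lextSeq M).f =
        (projectiveResolution (lextSeq M).X₃).complex.d (0 + 1) 0 ≫ g₀ ∧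
      ∀ (n : ℕ) (N : ModuleCat.{u} (UL k g)),
        derivedShift (tensorRight k (UL k g) N) _ _ F n =
          ((Tor k (UL k g) (n + 1)).map ((resR₁ k g).map w)).app N ≫ cap k (lextClass M) n N := by
  obtain ⟨f, hf, g₀, v, hg, hfS, he⟩ := exists_cocycle_of_shortExact (lextSeq_shortExact M)
    (projectiveResolution (lextSeq M).X₃)
  obtain ⟨w, rfl⟩ := exists_resR₁_map_eq v
  obtain ⟨F, hF⟩ := exists_liftCocycle (projectiveResolution (lextSeq M).X₃)
    (projectiveResolution (lextSeq M).X₁) 1 f hf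
  have hF' : F.f 0 ≫ augmentation (projectiveResolution (lextSeq M).X₁) = f :=
    hF.trans (Category.id_comp f)
  refine ⟨F, g₀, w, hg, ?_, fun n N => ?_⟩
  · rw [← Category.assoc, hF']
    exact hfS
  · exact (cap_eq_derivedShift k n N hf he F hF').symm.trans (cap_mk₀_comp k _ _ n N)

section

variable (M : RightLieMod k g) (N : LeftLieMod k g)

/-- The Tor isomorphism for lext(M), factored through Tor of M^{d₁}; it makes the map induced by
`lextSnd` a split monomorphism. -/
theorem isIso_leftDerived_map_lextSnd_comp_comparison (n : ℕ) :
    IsIso (((tensorRight k (UL k g) ((resL₁ k g).obj N)).leftDerived n).map (lextSnd M) ≫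
      comparison (tensorResNat N) n M) :=
  isIso_leftDerived_map_comp_comparison (tensorResNat N) lextSndNat
    (isIso_map_lextSnd_comp_tensorRes N) n M

/-- An extension becomes trivial when pulled back along its own epimorphism. -/
theorem leftDerived_map_lextSnd_comp_cap (n : ℕ) :
    ((tensorRight k (UL k g) ((resL₁ k g).obj N)).leftDerived (n + 1)).map (lextSnd M) ≫
      cap k (lextClass M) n ((resL₁ k g).obj N) = 0 := by
  refine (cap_mk₀_comp k (lextClass M) (lextSnd M) n ((resL₁ k g).obj N)).symm.trans ?_
  have h : (Abelian.Ext.mk₀ (lextSnd M)).comp (lextClass M) (zero_add 1) = 0 :=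
    (lextSeq_shortExact M).comp_extClass
  rw [h]
  exact cap_zero k n _

/-- It is annihilated by the map induced by `lextSnd`, which is a monomorphism. By exactness the
connecting maps are then surjective. -/
theorem leftDerived_map_lextInl_eq_zero (n : ℕ) :
    ((tensorRight k (UL k g) ((resL₁ k g).obj N)).leftDerived n).map (lextInl M) = 0 := by
  have := isIso_leftDerived_map_lextSnd_comp_comparison M N n
  have h : ((tensorRight k (UL k g) ((resL₁ k g).obj N)).leftDerived n).map (lextInl M) ≫
      ((tensorRight k (UL k g) ((resL₁ k g).obj N)).leftDerived n).map (lextSnd M) = 0 := by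
    rw [← Functor.map_comp]
    exact (congrArg _ (lextSeq M).zero).trans (leftDerived_map_zero _ n _ _)
  rw [← cancel_mono (((tensorRight k (UL k g) ((resL₁ k g).obj N)).leftDerived n).map
    (lextSnd M) ≫ comparison (tensorResNat N) n M), ← Category.assoc, h, zero_comp, zero_comp]

theorem exists_of_cap_lextClass_eq_zero (n : ℕ)
    (x : ((tensorRight k (UL k g) ((resL₁ k g).obj N)).leftDerived (n + 1)).obj
      ((resR₁ k g).obj M))
    (hx : (cap k (lextClass M) n ((resL₁ k g).obj N)).hom x = 0) :
    ∃ y, ((tensorRight k (UL k g) ((resL₁ k g).obj N)).leftDerived (n + 1)).map (lextSnd M) y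
      = x := by
  obtain ⟨F, g₀, w, hg, hF, h⟩ := exists_derivedShift_eq_cap M
  refine exists_of_derivedShift_eq_zero (lextSeq_shortExact M) _ _ F g₀ hg hF
    (tensorRight k (UL k g) ((resL₁ k g).obj N)) n x ?_
  -- Naturality moves `w` behind the cap product, so an element killed by the cap product is killed
  -- by the connecting map.
  have e := (h n ((resL₁ k g).obj N)).trans (cap_lextClass_naturality w n _)
  refine (congrArg (fun φ => φ.hom x) e).trans ?_
  exact (congrArg (((Tor k (UL k g) n).map ((resR₀ k g).map (tensorDown.map w))).app
    ((resL₁ k g).obj N)).hom hx).trans (map_zero _)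

theorem cap_lextClass_surjective (n : ℕ) :
    Function.Surjective (cap k (lextClass M) n ((resL₁ k g).obj N)).hom := by
  intro z
  obtain ⟨F, g₀, w, hg, hF, h⟩ := exists_derivedShift_eq_cap M
  obtain ⟨y, hy⟩ := exists_derivedShift_eq (lextSeq_shortExact M) _ _ F g₀ hg hF
    (tensorRight k (UL k g) ((resL₁ k g).obj N)) n z
    (congrArg (fun φ => φ.hom z) (leftDerived_map_lextInl_eq_zero M N n))
  -- Here `w` stays in front: a preimage under the connecting map, moved by `w`, is a preimage under
  -- the cap product.
  exact ⟨_, (congrArg (fun φ => φ.hom y) (h n ((resL₁ k g).obj N))).symm.trans hy⟩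

theorem leftDerived_zero_map_lextSnd_surjective :
    Function.Surjective
      (((tensorRight k (UL k g) ((resL₁ k g).obj N)).leftDerived 0).map (lextSnd M)) := by
  obtain ⟨F, g₀, w, hg, hF, -⟩ := exists_derivedShift_eq_cap M
  exact leftDerived_zero_map_surjective (lextSeq_shortExact M) _ _ F g₀ hg hF _

end

/-! ### The splitting -/

variable (k g)

/-- The map `Tor^{UL(g)}_n(M^{d₁}, ^{d₁}N) → Tor^{U(g_Lie)}_n(M, N)` induced by `d₁`. -/
noncomputable def torComparison (n : ℕ) : torSym k g n ⟶ torLie k g n where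
  app M :=
    { app := fun N => comparison (tensorResNat N) n M
      naturality := fun N N' h => (comparison_natural (tensorResNat N) (tensorResNat N')
        (tensorRightMap k (UL k g) ((resL₁ k g).map h)) (tensorRightMap k (U k g) h)
        (tensorResNat_naturality h) n M).symm }
  naturality M M' φ := by
    ext N : 2
    exact comparison_naturality (tensorResNat N) n φ

/-- The cap product with `[lext(M)]`, as a natural transformation. -/
noncomputable def capLextNat (n : ℕ) : torSym k g n ⟶ torDown k g n where
  app M :=
    { app := fun N => capLext k g n M N
      naturality := fun N N' h => by
        cases n with
        | zero => exact comp_zero.trans zero_comp.symm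
        | succ n => exact (cap_natural k (lextClass M) n ((resL₁ k g).map h)).symm }
  naturality M M' φ := by
    ext N : 2
    cases n with
    | zero => exact comp_zero.trans zero_comp.symm
    | succ n => exact cap_lextClass_naturality φ n ((resL₁ k g).obj N)

theorem isIso_lift_app_app (n : ℕ) (M : RightLieMod k g) (N : LeftLieMod k g) :
    IsIso (((biprod.lift (torComparison k g n) (capLextNat k g n)).app M).app N) := by
  have hp : ((biprod.lift (torComparison k g n) (capLextNat k g n)).app M).app N ≫
      ((biprod.fst : torLie k g n ⊞ torDown k g n ⟶ _).app M).app N =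
      comparison (tensorResNat N) n M :=
    congrArg (fun φ : torSym k g n ⟶ torLie k g n => (φ.app M).app N)
      (biprod.lift_fst (torComparison k g n) (capLextNat k g n))
  have hq : ((biprod.lift (torComparison k g n) (capLextNat k g n)).app M).app N ≫
      ((biprod.snd : torLie k g n ⊞ torDown k g n ⟶ _).app M).app N = capLext k g n M N :=
    congrArg (fun φ : torSym k g n ⟶ torDown k g n => (φ.app M).app N)
      (biprod.lift_snd (torComparison k g n) (capLextNat k g n))
  have hpq := congrArg
    (fun φ : torLie k g n ⊞ torDown k g n ⟶ torLie k g n ⊞ torDown k g n => (φ.app M).app N)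
    (biprod.total (X := torLie k g n) (Y := torDown k g n))
  cases n with
  | zero =>
    -- In degree 0 the second summand is zero and the cap component is the zero map, so all of
    -- Tor₀(M^{d₁}, N) has to come from lext(M): the right end of the long exact sequence.
    exact isIso_of_biproduct
      (((tensorRight k (UL k g) ((resL₁ k g).obj N)).leftDerived 0).map (lextSnd M)) _
      (capLext k g 0 M N) (isIso_leftDerived_map_lextSnd_comp_comparison M N 0) comp_zero
      (fun x _ => leftDerived_zero_map_lextSnd_surjective M N x) (fun z => ⟨0, rfl⟩)
      _ _ _ _ _ hp hq hpq
  | succ n =>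
    exact isIso_of_biproduct
      (((tensorRight k (UL k g) ((resL₁ k g).obj N)).leftDerived (n + 1)).map (lextSnd M)) _
      (capLext k g (n + 1) M N) (isIso_leftDerived_map_lextSnd_comp_comparison M N (n + 1))
      (leftDerived_map_lextSnd_comp_cap M N n)
      (exists_of_cap_lextClass_eq_zero M N n) (cap_lextClass_surjective M N n)
      _ _ _ _ _ hp hq hpq

theorem isIso_lift_torComparison_capLextNat (n : ℕ) :
    IsIso (biprod.lift (torComparison k g n) (capLextNat k g n)) := by
  rw [NatTrans.isIso_iff_isIso_app]
  intro M
  rw [NatTrans.isIso_iff_isIso_app]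
  exact isIso_lift_app_app k g n M

end LeibnizAlg

theorem theorem8p4 (k g : Type u) [Field k] [NonUnitalNonAssocRing g] [Module k g]
    [IsScalarTower k g g] [SMulCommClass k g g] [IsLeibniz g] (n : ℕ) :
    ∃ Φ : LeibnizAlg.torSym k g n ≅ LeibnizAlg.torLie k g n ⊞ LeibnizAlg.torDown k g n,
      ∀ (M : LeibnizAlg.RightLieMod k g) (N : LeibnizAlg.LeftLieMod k g),
        ((Φ.hom ≫ biprod.snd).app M).app N = LeibnizAlg.capLext k g n M N := by
  have := LeibnizAlg.isIso_lift_torComparison_capLextNat k g n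
  refine ⟨asIso (biprod.lift (LeibnizAlg.torComparison k g n) (LeibnizAlg.capLextNat k g n)),
    fun M N => ?_⟩
  rw [asIso_hom, biprod.lift_snd]
  rfl
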